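/- Let $\mathcal H$ be a complex Hilbert space with an orthonormal (Fock) basis $(|k\rangle)_{k\in\mathbb N}$, let ${\bf a}$ be the annihilation operator (${\bf a}|0\rangle=0$, ${\bf a}|k+1\rangle=\sqrt{k+1}\,|k\rangle$, with its maximal domain), let $l\in\mathbb N$ and $T>0$, and put ${\bf L}={\bf a}^l$, ${\bf G}=-\tfrac12{\bf L}^\dagger{\bf L}$, ${\bf \Lambda}=\mathrm{Id}+{\bf L}^\dagger{\bf L}$. Write $\|A\|_1=\mathrm{tr}\sqrt{A^\dagger A}$ for the trace norm, $\mathcal K^1$ for the trace class operators, and, for $\rho={\bf \Lambda}^{-2}\sigma{\bf \Lambda}^{-2}$ with $\sigma\in\mathcal K^1$, $\|\rho\|_{\mathcal K_{{\bf \Lambda}^4}}=\|\sigma\|_1$. There is exactly one quantum dynamical semigroup $(\mathcal T_t)_{t\ge0}$ on $B(\mathcal H)$ (a semigroup of normal completely positive maps with $\mathcal T_0=\mathrm{id}$ and $\mathcal T_t(\mathrm{Id})\le\mathrm{Id}$, ultraweakly continuous at $t=0$) that solves the $l$-photon loss equation $\dot\rho=D[{\bf a}^l](\rho)={\bf L}\rho{\bf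 L}^\dagger-\tfrac12{\bf L}^\dagger{\bf L}\rho-\tfrac12\rho{\bf L}^\dagger{\bf L}$ in the weak sense $$\langle v|\mathcal T_t(X)u\rangle=\langle v|Xu\rangle+\int_0^t\Big(\langle {\bf G}v|\mathcal T_s(X)u\rangle+\langle v|\mathcal T_s(X){\bf G}u\rangle+\langle {\bf L}v|\mathcal T_s(X){\bf L}u\rangle\Big)ds$$ for all $u,v\in\mathcal D({\bf G})$, $X\in B(\mathcal H)$, $t\ge0$. Let $\mathcal S_t$ be its pre-dual: $\mathcal S_t(\rho_0)\in\mathcal K^1$ is determined by $\mathrm{tr}(\mathcal S_t(\rho_0)X)=\mathrm{tr}(\rho_0\mathcal T_t(X))$ for all $X\in B(\mathcal H)$. For $n\in\mathbb N$ let $\mathcal H_n=\mathrm{span}\{|k\rangle : 0\le k\le n\}$ with orthogonal projector ${\bf P}_n$, ${\bf L}_n={\bf P}_n{\bf a}^l{\bf P}_n$, and for $\Delta t>0$ let $${\bf S}=\mathrm{Id}+\tfrac14(\Delta t\,{\bf L}_n^\dagger{\bf L}_n)^2,\quad \widetilde{\bf M}_0=(\mathrm{Id}-\tfrac{\Delta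 t}2{\bf L}_n^\dagger{\bf L}_n){\bf S}^{-1/2},\quad \widetilde{\bf M}_1=\sqrt{\Delta t}\,{\bf L}_n{\bf S}^{-1/2},$$ $$\mathcal F_{\Delta t,n}(\rho)=\widetilde{\bf M}_0\rho\widetilde{\bf M}_0^\dagger+\widetilde{\bf M}_1\rho\widetilde{\bf M}_1^\dagger .$$ Then there is a constant $C>0$ such that for every $n\in\mathbb N$ and every positive trace class operator $\rho_0$ supported on $\mathcal H_n$ (that is, ${\bf P}_n\rho_0{\bf P}_n=\rho_0$), one has $\|\rho_0\|_{\mathcal K_{{\bf \Lambda}^4}}<\infty$, the state $\mathcal S_T(\rho_0)$ exists and is unique, and for every $\Delta t>0$ and $N\in\mathbb N$ with $N\Delta t=T$, $$\|\mathcal S_T(\rho_0)-\mathcal F_{\Delta t,n}^N(\rho_0)\|_1\le C\,\|\rho_0\|_{\mathcal K_{{\bf \Lambda}^4}}\,\Delta t .$$ In particular $C$ does not depend on $n$, $\rho_0$, $\Delta t$ or $N$: there is no CFL-type restriction linking $\Delta t$ to $n$. -/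

import Mathlib

open scoped ComplexOrder NNReal ENNReal

noncomputable section

namespace PhotonLoss

/-! ### Unbounded operators on a Hilbert space -/

section Unbounded

variable {H : Type*} [NormedAddCommGroup H] [InnerProductSpace ℂ H]

/-- The composition `g f` of two unbounded operators, on its natural domain
`{x ∈ D(f) | f x ∈ D(g)}`. -/
def pcomp (g f : H →ₗ.[ℂ] H) : H →ₗ.[ℂ] H where
  domain :=
    { carrier := {x | ∃ h : x ∈ f.domain, f ⟨x, h⟩ ∈ g.domain}
      zero_mem' := ⟨f.domain.zero_mem, by
        have h0 : f ⟨0, f.domain.zero_mem⟩ = 0 := f.toFun.map_zero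
        rw [h0]; exact g.domain.zero_mem⟩
      add_mem' := by
        rintro x y ⟨hx, hx'⟩ ⟨hy, hy'⟩
        refine ⟨f.domain.add_mem hx hy, ?_⟩
        have h : f ⟨x + y, f.domain.add_mem hx hy⟩ = f ⟨x, hx⟩ + f ⟨y, hy⟩ :=
          f.toFun.map_add ⟨x, hx⟩ ⟨y, hy⟩
        rw [h]; exact g.domain.add_mem hx' hy'
      smul_mem' := by
        rintro c x ⟨hx, hx'⟩
        refine ⟨f.domain.smul_mem c hx, ?_⟩
        have h : f ⟨c • x, f.domain.smul_mem c hx⟩ = c • f ⟨x, hx⟩ :=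
          f.toFun.map_smul c ⟨x, hx⟩
        rw [h]; exact g.domain.smul_mem c hx' }
  toFun :=
    { toFun := fun x => g ⟨f ⟨x.1, x.2.fst⟩, x.2.snd⟩
      map_add' := by
        rintro ⟨x, hx, hx'⟩ ⟨y, hy, hy'⟩
        have h : f ⟨x + y, f.domain.add_mem hx hy⟩ = f ⟨x, hx⟩ + f ⟨y, hy⟩ :=
          f.toFun.map_add ⟨x, hx⟩ ⟨y, hy⟩
        have h2 := g.toFun.map_add ⟨f ⟨x, hx⟩, hx'⟩ ⟨f ⟨y, hy⟩, hy'⟩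
        refine Eq.trans ?_ h2
        exact congrArg g.toFun (Subtype.ext h)
      map_smul' := by
        rintro c ⟨x, hx, hx'⟩
        have h : f ⟨c • x, f.domain.smul_mem c hx⟩ = c • f ⟨x, hx⟩ :=
          f.toFun.map_smul c ⟨x, hx⟩
        have h2 := g.toFun.map_smul c ⟨f ⟨x, hx⟩, hx'⟩
        refine Eq.trans ?_ h2
        exact congrArg g.toFun (Subtype.ext h) }

/-- The identity as an everywhere defined unbounded operator. -/
def pid : H →ₗ.[ℂ] H := (LinearMap.id : H →ₗ[ℂ] H).toPMap ⊤

/-- The powers `A ^ m` of an unbounded operator, on their natural domains. -/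
def ppow (A : H →ₗ.[ℂ] H) : ℕ → (H →ₗ.[ℂ] H)
  | 0 => pid
  | m + 1 => pcomp A (ppow A m)

/-- `R` is the bounded, everywhere defined inverse of the unbounded operator `A`. -/
def IsBoundedInverse (A : H →ₗ.[ℂ] H) (R : H →L[ℂ] H) : Prop :=
  (∀ x : H, ∃ h : R x ∈ A.domain, A ⟨R x, h⟩ = x) ∧ ∀ y : A.domain, R (A y) = y

/-- `L† L` on its natural domain `{x ∈ D(L) | L x ∈ D(L†)}`. -/
def normalSq [CompleteSpace H] (L : H →ₗ.[ℂ] H) : H →ₗ.[ℂ] H := pcomp L.adjoint L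

end Unbounded

variable {H : Type*} [NormedAddCommGroup H] [InnerProductSpace ℂ H] [CompleteSpace H]

/-! ### Trace, trace norm, weighted trace norm -/

/-- The trace norm `‖A‖₁ = tr |A|`, `|A| = (A† A)^{1/2}`, computed in the orthonormal basis `b`;
it is `∞` when `A` is not trace class. -/
def traceNorm (b : HilbertBasis ℕ ℂ H) (A : H →L[ℂ] H) : ℝ≥0∞ :=
  ∑' k, ENNReal.ofReal (inner ℂ (b k) (CFC.abs A (b k))).re

/-- `A ∈ 𝒦¹`. -/
def IsTraceClass (b : HilbertBasis ℕ ℂ H) (A : H →L[ℂ] H) : Prop :=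
  traceNorm b A < ∞

/-- The trace of a (trace class) operator. -/
def trace (b : HilbertBasis ℕ ℂ H) (A : H →L[ℂ] H) : ℂ :=
  ∑' k, inner ℂ (b k) (A (b k))

/-- The norm of the space `𝒦_{Λ^{2m}} = {Λ^{-m} σ Λ^{-m} | σ ∈ 𝒦¹}`, i.e. `‖σ‖₁` where
`ρ = Λ^{-m} σ Λ^{-m}` (such a `σ` is unique when it exists). It is `∞` when `ρ` is not in this
space. -/
def weightedTraceNorm (b : HilbertBasis ℕ ℂ H) (Λ : H →ₗ.[ℂ] H) (m : ℕ) (ρ : H →L[ℂ] H) : ℝ≥0∞ :=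
  ⨅ (R : H →L[ℂ] H) (_ : IsBoundedInverse (ppow Λ m) R) (σ : H →L[ℂ] H) (_ : ρ = R * σ * R),
    traceNorm b σ

/-! ### Lindblad equations with one jump operator and no Hamiltonian -/

/-- Quantum dynamical semigroups on `B(H)`. -/
structure IsQuantumDynamicalSemigroup (b : HilbertBasis ℕ ℂ H)
    (𝒯 : ℝ≥0 → (H →L[ℂ] H) →ₗ[ℂ] (H →L[ℂ] H)) : Prop where
  zero : ∀ X, 𝒯 0 X = X
  add : ∀ t s X, 𝒯 (t + s) X = 𝒯 t (𝒯 s X)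
  subunital : ∀ t, 𝒯 t 1 ≤ 1
  completelyPositive : ∀ (t : ℝ≥0) (m : ℕ) (X Y : Fin m → (H →L[ℂ] H)),
    0 ≤ ∑ j, ∑ i, star (Y i) * 𝒯 t (star (X i) * X j) * Y j
  normal : ∀ (X : ℕ → (H →L[ℂ] H)) (X' : H →L[ℂ] H),
    (∀ u v : H, Filter.Tendsto (fun k => inner ℂ u (X k v)) Filter.atTop
      (nhds (inner ℂ u (X' v)))) →
    ∀ (t : ℝ≥0) (u v : H), Filter.Tendsto (fun k => inner ℂ u (𝒯 t (X k) v)) Filter.atTop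
      (nhds (inner ℂ u (𝒯 t X' v)))
  ultraweak : ∀ ρ X : H →L[ℂ] H, IsTraceClass b ρ →
    Filter.Tendsto (fun t => trace b (ρ * 𝒯 t X)) (nhdsWithin 0 (Set.Ioi 0))
      (nhds (trace b (ρ * X)))

/-- The operator `G = - L† L / 2`. -/
def effectiveGenerator (L : H →ₗ.[ℂ] H) : H →ₗ.[ℂ] H := (-(1 / 2) : ℂ) • normalSq L

/-- The expression `⟪G v, X u⟫ + ⟪v, X G u⟫ + ⟪L v, X L u⟫`, i.e. the form of
`D*[L](X) = L† X L - (L† L X + X L† L) / 2`, for `u, v ∈ D(G)`. -/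
def dissipatorForm (L : H →ₗ.[ℂ] H) (X : H →L[ℂ] H) (v u : (effectiveGenerator L).domain) : ℂ :=
  inner ℂ (effectiveGenerator L v) (X u)
    + inner ℂ (v : H) (X (effectiveGenerator L u))
    + inner ℂ (L ⟨v, v.2.fst⟩) (X (L ⟨u, u.2.fst⟩))

/-- The quantum dynamical semigroup `𝒯` solves (in the Heisenberg picture) the Lindblad equation
`dρ/dt = D[L](ρ)`, in the weak sense: for all `u, v ∈ D(G)`, `X ∈ B(H)`, `t ≥ 0`,
`⟪v, 𝒯_t(X) u⟫ = ⟪v, X u⟫ + ∫₀ᵗ (⟪G v, 𝒯_s(X) u⟫ + ⟪v, 𝒯_s(X) G u⟫ + ⟪L v, 𝒯_s(X) L u⟫) ds`. -/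
structure IsLindbladSemigroup (b : HilbertBasis ℕ ℂ H) (L : H →ₗ.[ℂ] H)
    (𝒯 : ℝ≥0 → (H →L[ℂ] H) →ₗ[ℂ] (H →L[ℂ] H)) : Prop where
  isQuantumDynamicalSemigroup : IsQuantumDynamicalSemigroup b 𝒯
  integrable : ∀ (u v : (effectiveGenerator L).domain) (X : H →L[ℂ] H) (t : ℝ≥0),
    IntervalIntegrable (fun s : ℝ => dissipatorForm L (𝒯 s.toNNReal X) v u)
      MeasureTheory.volume 0 t
  weak : ∀ (u v : (effectiveGenerator L).domain) (X : H →L[ℂ] H) (t : ℝ≥0),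
    inner ℂ (v : H) (𝒯 t X u) = inner ℂ (v : H) (X u)
      + ∫ s in (0 : ℝ)..t, dissipatorForm L (𝒯 s.toNNReal X) v u

/-- `ρt = 𝒮_t(ρ₀)`, where `𝒮` is the pre-dual semigroup of `𝒯`: `ρt` is the trace class operator
such that `tr (ρt X) = tr (ρ₀ 𝒯_t(X))` for all `X ∈ B(H)`. -/
def IsPredualState (b : HilbertBasis ℕ ℂ H) (𝒯 : ℝ≥0 → (H →L[ℂ] H) →ₗ[ℂ] (H →L[ℂ] H))
    (t : ℝ≥0) (ρ₀ ρt : H →L[ℂ] H) : Prop :=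
  IsTraceClass b ρt ∧ ∀ X : H →L[ℂ] H, trace b (ρt * X) = trace b (ρ₀ * 𝒯 t X)

/-! ### The annihilation operator and the Fock truncation -/

/-- The linear map `ψ ↦ (√(k+1) ψₖ₊₁)ₖ` from `H` to all sequences. -/
def lowering (b : HilbertBasis ℕ ℂ H) : H →ₗ[ℂ] (ℕ → ℂ) where
  toFun ψ := fun k => (√((k : ℝ) + 1) : ℂ) * b.repr ψ (k + 1)
  map_add' x y := by
    funext k
    rw [map_add]
    exact mul_add _ _ _
  map_smul' c x := by
    funext k
    rw [map_smul]
    exact mul_left_comm _ _ _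

/-- The annihilation operator `a ψ = ∑ₖ √(k+1) ψₖ₊₁ |k⟩` of the Fock basis `b`, with its maximal
domain `{ψ | ∑ₖ (k+1) |ψₖ₊₁|² < ∞}`; in particular `a |k+1⟩ = √(k+1) |k⟩`. -/
def annihilation (b : HilbertBasis ℕ ℂ H) : H →ₗ.[ℂ] H where
  domain :=
    { carrier := {ψ | Memℓp (lowering b ψ) 2}
      zero_mem' := by
        rw [Set.mem_ofPred_eq, map_zero]
        exact zero_memℓp
      add_mem' := by
        intro x y hx hy
        rw [Set.mem_ofPred_eq, map_add]
        exact Memℓp.add hx hy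
      smul_mem' := by
        intro c x hx
        rw [Set.mem_ofPred_eq, map_smul]
        exact Memℓp.const_smul hx c }
  toFun :=
    { toFun := fun ψ => b.repr.symm ⟨lowering b ψ, ψ.2⟩
      map_add' := by
        rintro ⟨x, hx⟩ ⟨y, hy⟩
        rw [← map_add]
        exact congrArg b.repr.symm (Subtype.ext ((lowering b).map_add x y))
      map_smul' := by
        rintro c ⟨x, hx⟩
        rw [RingHom.id_apply, ← map_smul]
        exact congrArg b.repr.symm (Subtype.ext ((lowering b).map_smul c x)) }

/-- `H_n = span {|k⟩ | 0 ≤ k ≤ n}`. -/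
def fockSpace (b : HilbertBasis ℕ ℂ H) (n : ℕ) : Submodule ℂ H :=
  Submodule.span ℂ (b '' Set.Iic n)

instance (b : HilbertBasis ℕ ℂ H) (n : ℕ) : FiniteDimensional ℂ (fockSpace b n) :=
  FiniteDimensional.span_of_finite ℂ ((Set.finite_Iic n).image b)

/-- The orthogonal projector `P_n` onto `H_n`. -/
def fockProj (b : HilbertBasis ℕ ℂ H) (n : ℕ) : H →L[ℂ] H := (fockSpace b n).starProjection

theorem annihilation_basis (b : HilbertBasis ℕ ℂ H) (k : ℕ) :
    ∃ h : b k ∈ (annihilation b).domain,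
      annihilation b ⟨b k, h⟩ = (√(k : ℝ) : ℂ) • b (k - 1) := by
  have e : lowering b (b k)
      = fun j => ((√(k : ℝ) : ℂ) • b.repr (b (k - 1))) j := by
    funext j
    change (√((j : ℝ) + 1) : ℂ) * b.repr (b k) (j + 1) = _
    simp only [HilbertBasis.repr_self, lp.single_apply, Pi.single_apply, lp.coeFn_smul,
      Pi.smul_apply, smul_eq_mul]
    rcases k with _ | k
    · simp
    · by_cases hj : j = k
      · subst hj; simp
      · simp [hj]
  have h : b k ∈ (annihilation b).domain := by
    change Memℓp _ 2
    rw [e]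
    exact ((√(k : ℝ) : ℂ) • b.repr (b (k - 1))).2
  refine ⟨h, ?_⟩
  have e2 : annihilation b ⟨b k, h⟩ = b.repr.symm ((√(k : ℝ) : ℂ) • b.repr (b (k - 1))) := by
    change b.repr.symm _ = _
    congr 1
    exact Subtype.ext e
  rw [e2, ← map_smul, LinearIsometryEquiv.symm_apply_apply]

theorem annihilation_fockSpace (b : HilbertBasis ℕ ℂ H) (n : ℕ) {x : H} (hx : x ∈ fockSpace b n) :
    ∃ h : x ∈ (annihilation b).domain, annihilation b ⟨x, h⟩ ∈ fockSpace b n := by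
  have key : fockSpace b n ≤ (pcomp (((LinearMap.id : H →ₗ[ℂ] H)).toPMap (fockSpace b n))
      (annihilation b)).domain := by
    refine Submodule.span_le.2 ?_
    rintro _ ⟨k, hk, rfl⟩
    obtain ⟨h, e⟩ := annihilation_basis b k
    refine ⟨h, ?_⟩
    rw [e]
    exact (fockSpace b n).smul_mem _
      (Submodule.subset_span ⟨k - 1, le_trans (Nat.sub_le _ _) hk, rfl⟩)
  exact key hx

theorem ppow_annihilation_fockSpace (b : HilbertBasis ℕ ℂ H) (l n : ℕ) {x : H}
    (hx : x ∈ fockSpace b n) :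
    ∃ h : x ∈ (ppow (annihilation b) l).domain,
      ppow (annihilation b) l ⟨x, h⟩ ∈ fockSpace b n := by
  induction l with
  | zero => exact ⟨trivial, hx⟩
  | succ l ih =>
    obtain ⟨h, h'⟩ := ih
    obtain ⟨h2, h2'⟩ := annihilation_fockSpace b n h'
    exact ⟨⟨h, h2⟩, h2'⟩

/-- The jump operator `L = a^l`. -/
def lossOp (b : HilbertBasis ℕ ℂ H) (l : ℕ) : H →ₗ.[ℂ] H := ppow (annihilation b) l

theorem fockSpace_le_lossOp_domain (b : HilbertBasis ℕ ℂ H) (l n : ℕ) :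
    fockSpace b n ≤ (lossOp b l).domain :=
  fun _ hx => (ppow_annihilation_fockSpace b l n hx).fst

/-- The reference operator `Λ = Id + L† L`, `L = a^l`. -/
def refOp (b : HilbertBasis ℕ ℂ H) (l : ℕ) : H →ₗ.[ℂ] H := pid + normalSq (lossOp b l)

/-- The truncated jump operator `L_n = P_n a^l P_n`. -/
def truncLossOp (b : HilbertBasis ℕ ℂ H) (l n : ℕ) : H →L[ℂ] H :=
  fockProj b n ∘L
    LinearMap.toContinuousLinearMap
      ((lossOp b l).toFun ∘ₗ Submodule.inclusion (fockSpace_le_lossOp_domain b l n)) ∘L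
    (fockSpace b n).orthogonalProjectionOnto

/-! ### The quantum channel scheme on the truncated space

Operators on `H_n` are identified with the operators `ρ` on `H` with `P_n ρ P_n = ρ`. On these,
the identity of `H` acts as that of `H_n`, and all operators below leave `H_n` invariant. -/

/-- `S_{Δt,n} = Id + (Δt L_n† L_n)² / 4`. -/
def schemeS (b : HilbertBasis ℕ ℂ H) (l n : ℕ) (Δt : ℝ) : H →L[ℂ] H :=
  1 + (1 / 4 : ℂ) • ((Δt : ℂ) • (star (truncLossOp b l n) * truncLossOp b l n)) ^ 2

/-- `M̃_{0,Δt,n} = (Id - (Δt / 2) L_n† L_n) S^{-1/2}`. -/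
def schemeM0 (b : HilbertBasis ℕ ℂ H) (l n : ℕ) (Δt : ℝ) : H →L[ℂ] H :=
  (1 - ((Δt / 2 : ℝ) : ℂ) • (star (truncLossOp b l n) * truncLossOp b l n))
    * schemeS b l n Δt ^ (-(1 / 2) : ℝ)

/-- `M̃_{1,Δt,n} = √Δt L_n S^{-1/2}`. -/
def schemeM1 (b : HilbertBasis ℕ ℂ H) (l n : ℕ) (Δt : ℝ) : H →L[ℂ] H :=
  (√Δt : ℂ) • truncLossOp b l n * schemeS b l n Δt ^ (-(1 / 2) : ℝ)

/-- One step `ℱ_{Δt,n}(ρ) = M̃₀ ρ M̃₀† + M̃₁ ρ M̃₁†` of the scheme. -/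
def scheme (b : HilbertBasis ℕ ℂ H) (l n : ℕ) (Δt : ℝ) (ρ : H →L[ℂ] H) : H →L[ℂ] H :=
  schemeM0 b l n Δt * ρ * star (schemeM0 b l n Δt)
    + schemeM1 b l n Δt * ρ * star (schemeM1 b l n Δt)

end PhotonLoss

end

/-! The jumps `a^l` only lower the photon number, so they leave every truncated space `H_n`
invariant. In the Heisenberg picture this says that the corner `P_n 𝒯_t(X) P_n` of a solution
obeys a closed linear differential equation with the bounded generator `truncGen b l n`
(`semiconjBy_corner_truncGen`). Everything rests on this fact.

*The semigroup.* The flows `truncEvol b l n t` of the truncated equations are compatible under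
corners and contractive, so the evolved corners of `X` are the corners of a single operator
`lossEvol b l t X`. Contractivity and complete positivity of `truncEvol` are inherited from the
scheme, which has both properties and converges to `truncEvol` (`tendsto_inner_schemeDual_pow`).
The weak Lindblad equation is the limit `n → ∞` of the equations of the corners (`lossEvol_weak`).
Conversely the matrix elements of any solution satisfy the weak equation tested on basis vectors,
so its corners solve the truncated differential equation, and are therefore determined
(`IsLindbladSemigroup.eq_lossEvol`).

*The error estimate.* With `Λ_n = 1 + L_n† L_n` and the weight `W = Λ_n²`, call `K` a form bound
of an operator `Z` when `|⟨v, Z u⟩| ≤ K ‖W v‖ ‖W u‖`. All operators of the scheme are weighted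
shifts of the Fock basis, so norm comparisons reduce to comparisons of their coefficients. Three
bounds hold with constants that do not depend on `n`.
* The truncated flow differs from its first order Taylor polynomial by at most `4 ‖X‖ Δt²`, since
  the square of the generator costs one factor `W` on each side (`formBound_truncEvol_sub`).
* One step of the dual scheme differs from the same polynomial by at most `5 ‖X‖ Δt²`
  (`formBound_schemeDual_sub`).
* The dual scheme does not increase form bounds, because `‖W M̃₀ v‖² + ‖W M̃₁ v‖² ≤ ‖W v‖²`: the
  Kraus operators are normalised and the jump moves to levels of smaller weight
  (`norm_sq_weightOp_schemeM0_add_schemeM1_le`). No restriction on `Δt` enters.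

A telescoping sum gives the form bound `9 T Δt` for the error on contractions
(`formBound_truncEvol_sub_schemeDual_pow`). Pairing a positive `ρ` with an operator of form bound
`K` gives at most `K tr (W ρ W)` (`IsTraceClass.norm_trace_le`), and `tr (W ρ W)` is the weighted
trace norm of `ρ` when `ρ` is supported on `H_n` (`weightedTraceNorm_eq_ofReal`). As the trace
norm of the error is its pairing with some contraction, the constant `C = 9 T` results. -/

noncomputable section

set_option linter.unusedSectionVars false

open Filter Topology

namespace PhotonLoss

variable {H : Type*} [NormedAddCommGroup H] [InnerProductSpace ℂ H] [CompleteSpace H]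

/-! ### Matrix elements in the Fock basis -/

section Matrix

variable (b : HilbertBasis ℕ ℂ H)

theorem inner_basis (j k : ℕ) : inner ℂ (b j) (b k) = if j = k then 1 else 0 :=
  orthonormal_iff_ite.1 b.orthonormal j k

theorem norm_basis (k : ℕ) : ‖b k‖ = 1 := b.orthonormal.1 k

theorem dense_span_range : Dense (Submodule.span ℂ (Set.range b) : Set H) :=
  Submodule.dense_iff_topologicalClosure_eq_top.2 b.dense_span

theorem ext_basis {E : Type*} [NormedAddCommGroup E] [NormedSpace ℂ E] {A B : H →L[ℂ] E}
    (h : ∀ k, A (b k) = B (b k)) : A = B := by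
  refine ContinuousLinearMap.ext_on (dense_span_range b) ?_
  rintro _ ⟨k, rfl⟩
  exact h k

theorem eq_of_inner_basis {x y : H} (h : ∀ k, inner ℂ (b k) x = inner ℂ (b k) y) : x = y := by
  apply b.repr.injective
  ext k
  rw [b.repr_apply_apply, b.repr_apply_apply, h]

theorem ext_matrix {A B : H →L[ℂ] H}
    (h : ∀ i j, inner ℂ (b i) (A (b j)) = inner ℂ (b i) (B (b j))) : A = B :=
  ext_basis b fun j => eq_of_inner_basis b fun i => h i j

theorem hasSum_norm_sq (x : H) : HasSum (fun k => ‖inner ℂ (b k) x‖ ^ 2) (‖x‖ ^ 2) := by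
  have h := (b.hasSum_inner_mul_inner x x).mapL Complex.reCLM
  convert h using 1
  · ext k
    rw [← inner_conj_symm x (b k), Complex.reCLM_apply, ← Complex.normSq_eq_conj_mul_self,
      Complex.ofReal_re, Complex.normSq_eq_norm_sq]
  · rw [Complex.reCLM_apply]
    exact (inner_self_eq_norm_sq (𝕜 := ℂ) x).symm

theorem basis_mem_fockSpace {n k : ℕ} (h : k ≤ n) : b k ∈ fockSpace b n :=
  Submodule.subset_span ⟨k, h, rfl⟩

theorem fockProj_basis (n k : ℕ) : fockProj b n (b k) = if k ≤ n then b k else 0 := by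
  split_ifs with h
  · exact Submodule.starProjection_eq_self_iff.2 (basis_mem_fockSpace b h)
  · refine (Submodule.starProjection_apply_eq_zero_iff _).2 ?_
    rw [fockSpace, Submodule.mem_orthogonal]
    intro u hu
    induction hu using Submodule.span_induction with
    | mem x hx =>
      obtain ⟨j, hj, rfl⟩ := hx
      rw [inner_basis, if_neg]
      rintro rfl
      exact h hj
    | zero => exact inner_zero_left _
    | add x y _ _ hx hy => rw [inner_add_left, hx, hy, add_zero]
    | smul c x _ hx => rw [inner_smul_left, hx, mul_zero]

theorem star_fockProj (n : ℕ) : star (fockProj b n) = fockProj b n :=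
  isSelfAdjoint_starProjection _

theorem inner_fockProj_left (n : ℕ) (x y : H) :
    inner ℂ (fockProj b n x) y = inner ℂ x (fockProj b n y) :=
  Submodule.inner_starProjection_left_eq_right _ x y

theorem inner_basis_fockProj (n k : ℕ) (x : H) :
    inner ℂ (b k) (fockProj b n x) = if k ≤ n then inner ℂ (b k) x else 0 := by
  rw [← inner_fockProj_left, fockProj_basis]
  split_ifs
  · rfl
  · exact inner_zero_left _

theorem fockProj_apply (n : ℕ) (x : H) :
    fockProj b n x = ∑ k ∈ Finset.range (n + 1), inner ℂ (b k) x • b k := by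
  refine eq_of_inner_basis b fun j => ?_
  simp [inner_basis_fockProj, inner_basis]

theorem tendsto_fockProj (x : H) : Tendsto (fun n => fockProj b n x) atTop (𝓝 x) := by
  have h := (b.hasSum_repr x).tendsto_sum_nat.comp (tendsto_add_atTop_nat 1)
  refine h.congr fun n => ?_
  rw [fockProj_apply]
  simp only [Function.comp, b.repr_apply_apply]

theorem norm_fockProj_apply_le (n : ℕ) (x : H) : ‖fockProj b n x‖ ≤ ‖x‖ :=
  Submodule.norm_starProjection_apply_le _ x

theorem fockProj_mul_fockProj {m n : ℕ} (h : m ≤ n) :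
    fockProj b m * fockProj b n = fockProj b m := by
  refine ext_basis b fun k => ?_
  rw [mul_apply_eq_comp, fockProj_basis, fockProj_basis]
  split_ifs with h1 h2 h2
  · rw [fockProj_basis, if_pos h2]
  · rw [fockProj_basis, if_neg h2]
  · omega
  · exact map_zero _

end Matrix

/-! ### Weighted shifts of the Fock basis -/

section Shift

variable (b : HilbertBasis ℕ ℂ H)

/-- `X` is the weighted shift `|k⟩ ↦ d k |k - s⟩`, the weights vanishing for `k < s`, so that the
truncated subtraction is harmless. For `s = 0` these are the operators diagonal in the basis. -/
structure IsShift (s : ℕ) (d : ℕ → ℝ) (X : H →L[ℂ] H) : Prop where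
  basis : ∀ k, X (b k) = (d k : ℂ) • b (k - s)
  vanish : ∀ k < s, d k = 0

variable {b} {s s' : ℕ} {d d' e : ℕ → ℝ} {X Y Z : H →L[ℂ] H}

theorem IsShift.congr (h : IsShift b s d X) (h' : ∀ k, d' k = d k) : IsShift b s d' X := by
  rwa [show d' = d from funext h']

theorem IsShift.eq (h : IsShift b s d X) (h' : IsShift b s d Y) : X = Y :=
  ext_basis b fun k => by rw [h.basis, h'.basis]

theorem IsShift.inner_basis_apply (h : IsShift b s d X) (j : ℕ) (v : H) :
    inner ℂ (b j) (X v) = d (j + s) * inner ℂ (b (j + s)) v := by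
  have key : (innerSL ℂ (b j)) ∘L X = (d (j + s) : ℂ) • innerSL ℂ (b (j + s)) := by
    refine ext_basis b fun k => ?_
    simp only [ContinuousLinearMap.comp_apply, innerSL_apply_apply, h.basis, inner_smul_right,
      smul_apply, inner_basis, smul_eq_mul]
    rcases lt_or_ge k s with hk | hk
    · rw [h.vanish k hk, if_neg (show ¬ j + s = k by omega)]
      simp
    · by_cases hj : j + s = k
      · subst hj; simp
      · rw [if_neg (show ¬ j = k - s by omega), if_neg hj]
        simp
  exact congrArg (fun f : H →L[ℂ] ℂ => f v) key

theorem IsShift.hasSum_norm_sq (h : IsShift b s d X) (v : H) :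
    HasSum (fun k => d k ^ 2 * ‖inner ℂ (b k) v‖ ^ 2) (‖X v‖ ^ 2) := by
  have h1 := PhotonLoss.hasSum_norm_sq b (X v)
  have h2 : (fun k => ‖inner ℂ (b k) (X v)‖ ^ 2)
      = fun k => d (k + s) ^ 2 * ‖inner ℂ (b (k + s)) v‖ ^ 2 := by
    funext k
    rw [h.inner_basis_apply, norm_mul, mul_pow, Complex.norm_real, Real.norm_eq_abs, sq_abs]
  rw [h2] at h1
  have h3 := (hasSum_nat_add_iff (f := fun k => d k ^ 2 * ‖inner ℂ (b k) v‖ ^ 2) s).1 h1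
  rwa [Finset.sum_eq_zero, add_zero] at h3
  intro k hk
  rw [h.vanish k (Finset.mem_range.1 hk)]
  simp

theorem IsShift.norm_apply_le (h : IsShift b s d X) (h' : IsShift b s' e Y) {c : ℝ} (hc : 0 ≤ c)
    (hde : ∀ k, |d k| ≤ c * |e k|) (v : H) : ‖X v‖ ≤ c * ‖Y v‖ := by
  refine le_of_sq_le_sq ?_ (by positivity)
  rw [mul_pow]
  refine hasSum_le (fun k => ?_) (h.hasSum_norm_sq v) ((h'.hasSum_norm_sq v).mul_left (c ^ 2))
  rw [← mul_assoc]
  refine mul_le_mul_of_nonneg_right ?_ (by positivity)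
  rw [← sq_abs (d k), ← sq_abs (e k), ← mul_pow]
  exact pow_le_pow_left₀ (abs_nonneg _) (hde k) 2

theorem IsShift.one : IsShift b 0 (fun _ => 1) (1 : H →L[ℂ] H) := ⟨fun k => by simp, by simp⟩

theorem IsShift.mul (h : IsShift b s d X) (h' : IsShift b s' d' Y) :
    IsShift b (s + s') (fun k => d' k * d (k - s')) (X * Y) where
  basis k := by
    rw [mul_apply_eq_comp, h'.basis, map_smul, h.basis, smul_smul, Nat.sub_sub,
      add_comm s s']
    push_cast
    rfl
  vanish k hk := by
    rcases lt_or_ge k s' with h1 | h1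
    · rw [h'.vanish k h1, zero_mul]
    · rw [h.vanish (k - s') (by omega), mul_zero]

theorem IsShift.mul_diag (h : IsShift b s d X) (h' : IsShift b 0 d' Y) :
    IsShift b s (fun k => d' k * d k) (X * Y) := h.mul h'

theorem IsShift.add (h : IsShift b s d X) (h' : IsShift b s d' Y) :
    IsShift b s (fun k => d k + d' k) (X + Y) where
  basis k := by
    rw [add_apply, h.basis, h'.basis, ← add_smul, Complex.ofReal_add]
  vanish k hk := by rw [h.vanish k hk, h'.vanish k hk, add_zero]

theorem IsShift.sub (h : IsShift b s d X) (h' : IsShift b s d' Y) :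
    IsShift b s (fun k => d k - d' k) (X - Y) where
  basis k := by
    rw [sub_apply, h.basis, h'.basis, ← sub_smul, Complex.ofReal_sub]
  vanish k hk := by rw [h.vanish k hk, h'.vanish k hk, sub_zero]

theorem IsShift.smul (h : IsShift b s d X) (c : ℝ) :
    IsShift b s (fun k => c * d k) ((c : ℂ) • X) where
  basis k := by rw [smul_apply, h.basis, smul_smul, Complex.ofReal_mul]
  vanish k hk := by rw [h.vanish k hk, mul_zero]

theorem IsShift.star_mul (h : IsShift b s d X) (h' : IsShift b s d' Y) :
    IsShift b 0 (fun k => d k * d' k) (star X * Y) where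
  basis k := by
    refine eq_of_inner_basis b fun j => ?_
    rw [mul_apply_eq_comp, ContinuousLinearMap.star_eq_adjoint,
      ContinuousLinearMap.adjoint_inner_right, h.basis, h'.basis, inner_smul_left,
      inner_smul_right, inner_smul_right, inner_basis, inner_basis, Complex.conj_ofReal,
      Nat.sub_zero]
    by_cases hjk : j = k
    · subst hjk; simp
    · rw [if_neg hjk]
      rcases lt_or_ge j s with hj | hj
      · rw [h.vanish j hj]; simp
      · rcases lt_or_ge k s with hk | hk
        · rw [h'.vanish k hk]; simp
        · rw [if_neg (show ¬ j - s = k - s by omega)]; simp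
  vanish k hk := absurd hk (Nat.not_lt_zero k)

theorem IsShift.star_diag (h : IsShift b 0 d X) : star X = X := by
  have h1 := h.star_mul IsShift.one
  rw [mul_one] at h1
  exact h1.eq (h.congr fun k => mul_one _)

/-- A diagonal operator with nonnegative entries is positive, being the square of a self-adjoint
diagonal operator. -/
theorem IsShift.mul_self_nonneg (h : IsShift b 0 d X) : 0 ≤ X * X := by
  have := star_mul_self_nonneg X
  rwa [h.star_diag] at this

theorem isShift_fockProj (n : ℕ) :
    IsShift b 0 (fun k => if k ≤ n then 1 else 0) (fockProj b n) where
  basis k := by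
    rw [fockProj_basis]
    split_ifs <;> simp
  vanish k hk := absurd hk (Nat.not_lt_zero k)

theorem IsShift.fockProj_mul_mul (h : IsShift b s d X) (n : ℕ) :
    fockProj b n * X * fockProj b n = X * fockProj b n := by
  refine ext_basis b fun k => ?_
  simp only [mul_apply_eq_comp, fockProj_basis]
  split_ifs with hk
  · rw [h.basis, map_smul, fockProj_basis, if_pos (by omega)]
  · simp

variable (b) in
theorem exists_isShift_diag (d : ℕ → ℝ) {C : ℝ} (hd : ∀ k, |d k| ≤ C) :
    ∃ X : H →L[ℂ] H, IsShift b 0 d X := by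
  have hC : 0 ≤ C := (abs_nonneg _).trans (hd 0)
  have hb (f : lp (fun _ : ℕ => ℂ) 2) (k : ℕ) : ‖(d k : ℂ) * f k‖ ≤ ‖((C : ℂ) • f) k‖ := by
    rw [norm_mul, lp.coeFn_smul, Pi.smul_apply, smul_eq_mul, norm_mul, Complex.norm_real,
      Complex.norm_real, Real.norm_eq_abs, Real.norm_of_nonneg hC]
    exact mul_le_mul_of_nonneg_right (hd k) (norm_nonneg _)
  have hm (f : lp (fun _ : ℕ => ℂ) 2) : Memℓp (fun k => (d k : ℂ) * f k) 2 :=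
    (lp.memℓp ((C : ℂ) • f)).mono' (hb f)
  let D : lp (fun _ : ℕ => ℂ) 2 →ₗ[ℂ] lp (fun _ : ℕ => ℂ) 2 :=
    { toFun := fun f => ⟨fun k => (d k : ℂ) * f k, hm f⟩
      map_add' := fun f g => by
        ext k
        exact mul_add _ _ _
      map_smul' := fun c f => by
        ext k
        exact mul_left_comm _ _ _ }
  have hD (f : lp (fun _ : ℕ => ℂ) 2) : ‖D f‖ ≤ C * ‖f‖ := by
    have := lp.norm_mono (p := 2) (by norm_num) (x := D f) (y := (C : ℂ) • f) (hb f)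
    rwa [norm_smul, Complex.norm_real, Real.norm_of_nonneg hC] at this
  refine ⟨(b.repr.symm.toContinuousLinearEquiv : _ →L[ℂ] H) ∘L D.mkContinuous C hD ∘L
    (b.repr.toContinuousLinearEquiv : H →L[ℂ] _), ⟨fun k => ?_, fun k hk => absurd hk k.not_lt_zero⟩⟩
  change b.repr.symm (D (b.repr (b k))) = _
  apply b.repr.injective
  rw [LinearIsometryEquiv.apply_symm_apply, map_smul, Nat.sub_zero]
  ext j
  change (d j : ℂ) * b.repr (b k) j = (d k : ℂ) * b.repr (b k) j
  rw [b.repr_apply_apply, inner_basis]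
  split_ifs with h
  · rw [h]
  · simp

end Shift

/-! ### The jump operator in the Fock basis -/

/-- The coefficient in `a^l |k⟩ = √(k (k-1) ⋯ (k-l+1)) |k - l⟩`; it vanishes for `k < l`. -/
def lossCoeff (l k : ℕ) : ℝ := √(k.descFactorial l : ℝ)

theorem lossCoeff_sq (l k : ℕ) : lossCoeff l k ^ 2 = k.descFactorial l :=
  Real.sq_sqrt (Nat.cast_nonneg _)

theorem lossCoeff_mul_self (l k : ℕ) : lossCoeff l k * lossCoeff l k = k.descFactorial l :=
  Real.mul_self_sqrt (Nat.cast_nonneg _)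

theorem lossCoeff_mul_self_cast (l k : ℕ) :
    (lossCoeff l k : ℂ) * lossCoeff l k = k.descFactorial l := by
  rw [← Complex.ofReal_mul, lossCoeff_mul_self, Complex.ofReal_natCast]

theorem lossCoeff_nonneg (l k : ℕ) : 0 ≤ lossCoeff l k := Real.sqrt_nonneg _

theorem lossCoeff_of_lt {l k : ℕ} (h : k < l) : lossCoeff l k = 0 := by
  rw [lossCoeff, Nat.descFactorial_of_lt h, Nat.cast_zero, Real.sqrt_zero]

theorem lossCoeff_succ (l k : ℕ) : lossCoeff (l + 1) k = √((k - l : ℕ) : ℝ) * lossCoeff l k := by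
  rw [lossCoeff, lossCoeff, Nat.descFactorial_succ, Nat.cast_mul, Real.sqrt_mul (Nat.cast_nonneg _)]

section Loss

variable (b : HilbertBasis ℕ ℂ H)

theorem lossOp_basis (l k : ℕ) :
    ∃ h : b k ∈ (lossOp b l).domain, lossOp b l ⟨b k, h⟩ = (lossCoeff l k : ℂ) • b (k - l) := by
  induction l with
  | zero => exact ⟨trivial, by simp [lossCoeff]; rfl⟩
  | succ l ih =>
    obtain ⟨h, e⟩ := ih
    obtain ⟨h', e'⟩ := annihilation_basis b (k - l)
    have h2 : lossOp b l ⟨b k, h⟩ ∈ (annihilation b).domain := by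
      rw [e]
      exact (annihilation b).domain.smul_mem _ h'
    refine ⟨⟨h, h2⟩, ?_⟩
    change annihilation b ⟨lossOp b l ⟨b k, h⟩, h2⟩ = _
    have h3 : (⟨lossOp b l ⟨b k, h⟩, h2⟩ : (annihilation b).domain)
        = (lossCoeff l k : ℂ) • ⟨b (k - l), h'⟩ := Subtype.ext e
    rw [h3, LinearPMap.map_smul, e', smul_smul, lossCoeff_succ, mul_comm, Nat.sub_sub]
    push_cast
    rfl

theorem inner_basis_annihilation (j : ℕ) (ψ : (annihilation b).domain) :
    inner ℂ (b j) (annihilation b ψ) = (√((j : ℝ) + 1) : ℂ) * inner ℂ (b (j + 1)) (ψ : H) := by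
  rw [← b.repr_apply_apply, ← b.repr_apply_apply]
  change b.repr (b.repr.symm _) j = _
  rw [LinearIsometryEquiv.apply_symm_apply]
  rfl

theorem inner_basis_lossOp (l j : ℕ) (ψ : (lossOp b l).domain) :
    inner ℂ (b j) (lossOp b l ψ) = lossCoeff l (j + l) * inner ℂ (b (j + l)) (ψ : H) := by
  induction l generalizing j with
  | zero =>
    simp only [lossCoeff, Nat.descFactorial_zero, Nat.cast_one, Real.sqrt_one, Complex.ofReal_one,
      one_mul, add_zero]
    rfl
  | succ l ih =>
    obtain ⟨ψ, h, h'⟩ := ψ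
    change inner ℂ (b j) (annihilation b ⟨lossOp b l ⟨ψ, h⟩, h'⟩) = _
    rw [inner_basis_annihilation]
    change _ * inner ℂ (b (j + 1)) (lossOp b l ⟨ψ, h⟩) = _
    rw [ih, lossCoeff_succ, show j + (l + 1) - l = j + 1 by omega,
      show j + 1 + l = j + (l + 1) by omega, ← mul_assoc]
    push_cast
    rfl

/-- The natural domain of `a^l` requires every intermediate power `a^m ψ` to exist, hence the
summability for all `m ≤ l`. -/
theorem mem_lossOp_domain (l : ℕ) (ψ : H)
    (h : ∀ m ≤ l, Summable fun k => (k.descFactorial m : ℝ) * ‖inner ℂ (b k) ψ‖ ^ 2) :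
    ψ ∈ (lossOp b l).domain := by
  induction l with
  | zero => trivial
  | succ l ih =>
    have h1 := ih fun m hm => h m (by omega)
    refine ⟨h1, ?_⟩
    change Memℓp (lowering b (lossOp b l ⟨ψ, h1⟩)) 2
    refine memℓp_gen ?_
    have h2 := (summable_nat_add_iff (l + 1)).2 (h (l + 1) le_rfl)
    refine h2.congr fun j => Eq.symm ?_
    change ‖(√((j : ℝ) + 1) : ℂ) * b.repr (lossOp b l ⟨ψ, h1⟩) (j + 1)‖ ^ (2 : ℝ≥0∞).toReal = _
    rw [b.repr_apply_apply, inner_basis_lossOp, ← mul_assoc, norm_mul, ENNReal.toReal_ofNat,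
      Real.rpow_ofNat, mul_pow, show j + 1 + l = j + (l + 1) by omega]
    congr 1
    rw [← Complex.ofReal_mul, Complex.norm_real, Real.norm_eq_abs, sq_abs, mul_pow,
      Real.sq_sqrt (by positivity), lossCoeff_sq, Nat.descFactorial_succ,
      show j + (l + 1) - l = j + 1 by omega]
    push_cast
    rfl

theorem dense_lossOp_domain (l : ℕ) : Dense ((lossOp b l).domain : Set H) := by
  refine (dense_span_range b).mono (Submodule.span_le.2 ?_)
  rintro _ ⟨k, rfl⟩
  exact (lossOp_basis b l k).fst

theorem inner_basis_normalSq (l k : ℕ) (ψ : (normalSq (lossOp b l)).domain) :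
    inner ℂ (b k) (normalSq (lossOp b l) ψ) = k.descFactorial l * inner ℂ (b k) (ψ : H) := by
  obtain ⟨ψ, h, h'⟩ := ψ
  change inner ℂ (b k) ((lossOp b l).adjoint ⟨lossOp b l ⟨ψ, h⟩, h'⟩) = _
  obtain ⟨hk, ek⟩ := lossOp_basis b l k
  have e := LinearPMap.adjoint_isFormalAdjoint (dense_lossOp_domain b l)
    ⟨lossOp b l ⟨ψ, h⟩, h'⟩ ⟨b k, hk⟩
  rw [← inner_conj_symm, e, inner_conj_symm, ek, inner_smul_left, inner_basis_lossOp,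
    Complex.conj_ofReal]
  rcases lt_or_ge k l with hkl | hkl
  · rw [lossCoeff_of_lt hkl, Nat.descFactorial_of_lt hkl]; simp
  · rw [Nat.sub_add_cancel hkl, ← mul_assoc, ← Complex.ofReal_mul, lossCoeff_mul_self]
    simp

theorem mem_normalSq_domain (l : ℕ) (ψ w : H) (h : ψ ∈ (lossOp b l).domain)
    (hw : ∀ k, inner ℂ (b k) w = k.descFactorial l * inner ℂ (b k) ψ) :
    ∃ h : ψ ∈ (normalSq (lossOp b l)).domain, normalSq (lossOp b l) ⟨ψ, h⟩ = w := by
  have h1 : lossOp b l ⟨ψ, h⟩ ∈ (lossOp b l).adjoint.domain := by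
    refine LinearPMap.mem_adjoint_domain_of_exists _ ⟨w, fun x => ?_⟩
    have e1 := b.hasSum_inner_mul_inner (lossOp b l ⟨ψ, h⟩) (lossOp b l x)
    have e2 := (hasSum_nat_add_iff' l).2 (b.hasSum_inner_mul_inner w (x : H))
    have e3 : ∑ i ∈ Finset.range l, inner ℂ w (b i) * inner ℂ (b i) (x : H) = 0 := by
      refine Finset.sum_eq_zero fun i hi => ?_
      rw [← inner_conj_symm, hw, Nat.descFactorial_of_lt (Finset.mem_range.1 hi)]
      simp
    rw [e3, sub_zero] at e2
    refine e2.unique (Eq.subst (motive := fun f => HasSum f _) (funext fun j => ?_) e1)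
    rw [← inner_conj_symm w, ← inner_conj_symm (lossOp b l ⟨ψ, h⟩), inner_basis_lossOp,
      inner_basis_lossOp, hw, ← lossCoeff_mul_self_cast, map_mul, map_mul, map_mul]
    simp only [Complex.conj_ofReal]
    ring
  refine ⟨⟨h, h1⟩, eq_of_inner_basis b fun k => ?_⟩
  rw [inner_basis_normalSq, hw]

theorem normalSq_basis (l k : ℕ) :
    ∃ h : b k ∈ (normalSq (lossOp b l)).domain,
      normalSq (lossOp b l) ⟨b k, h⟩ = (k.descFactorial l : ℂ) • b k := by
  refine mem_normalSq_domain b l (b k) _ (lossOp_basis b l k).fst fun j => ?_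
  rw [inner_smul_right, inner_basis]
  split_ifs with h
  · rw [h]
  · simp

/-! ### The reference operator -/

/-- The eigenvalues `1 + k (k-1) ⋯ (k-l+1)` of `Λ = 1 + L† L`. -/
def refCoeff (l k : ℕ) : ℝ := 1 + (k.descFactorial l : ℝ)

theorem one_le_refCoeff (l k : ℕ) : 1 ≤ refCoeff l k := le_add_of_nonneg_right (Nat.cast_nonneg _)

/-- The operators `(a^m)† a^m` with `m ≤ l` are relatively bounded by `Λ`. For `k ≥ l` the falling
factorial increases with its order; the finitely many `k < l` are absorbed in the constant. -/
theorem descFactorial_le_mul_refCoeff {l m : ℕ} (hm : m ≤ l) (k : ℕ) :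
    (k.descFactorial m : ℝ) ≤ (1 + l : ℝ) ^ l * refCoeff l k := by
  rcases lt_or_ge k l with hk | hk
  · have h1 : (k.descFactorial m : ℝ) ≤ (1 + l : ℝ) ^ l := by
      have h2 := Nat.descFactorial_le_pow k m
      have h3 : k ^ m ≤ (1 + l) ^ l :=
        (Nat.pow_le_pow_left (by omega) m).trans (Nat.pow_le_pow_right (by omega) hm)
      exact_mod_cast h2.trans h3
    exact h1.trans (le_mul_of_one_le_right (by positivity) (one_le_refCoeff l k))
  · have h1 : (k.descFactorial m : ℝ) ≤ k.descFactorial l := by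
      rw [← Nat.descFactorial_mul_descFactorial hm]
      have : 0 < (k - m).descFactorial (l - m) := Nat.pos_of_ne_zero fun h => by
        rw [Nat.descFactorial_eq_zero_iff_lt] at h
        omega
      exact_mod_cast Nat.le_mul_of_pos_left _ this
    have h2 : (1 : ℝ) ≤ (1 + l : ℝ) ^ l := one_le_pow₀ (by simp)
    refine h1.trans (le_trans ?_ (le_mul_of_one_le_left ?_ h2))
    · rw [refCoeff]; linarith
    · linarith [one_le_refCoeff l k]

theorem inner_basis_refOp (l k : ℕ) (ψ : (refOp b l).domain) :
    inner ℂ (b k) (refOp b l ψ) = refCoeff l k * inner ℂ (b k) (ψ : H) := by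
  have : refOp b l ψ = (ψ : H) + normalSq (lossOp b l) ⟨ψ, ψ.2.2⟩ := rfl
  rw [this, inner_add_right, inner_basis_normalSq, refCoeff]
  push_cast
  ring

theorem isBoundedInverse_refOp (l : ℕ) {R : H →L[ℂ] H}
    (hR : IsShift b 0 (fun k => (refCoeff l k)⁻¹) R) : IsBoundedInverse (refOp b l) R := by
  have hne (k : ℕ) : (refCoeff l k : ℂ) ≠ 0 := by
    have := one_le_refCoeff l k
    exact_mod_cast (by linarith : refCoeff l k ≠ 0)
  refine ⟨fun x => ?_, fun y => ?_⟩
  · have h1 : R x ∈ (lossOp b l).domain := by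
      refine mem_lossOp_domain b l _ fun m hm => ?_
      refine Summable.of_nonneg_of_le (fun k => by positivity) (fun k => ?_)
        ((hasSum_norm_sq b x).summable.mul_left ((1 + l : ℝ) ^ l))
      rw [hR.inner_basis_apply, add_zero, norm_mul, mul_pow, ← mul_assoc, Complex.norm_real,
        Real.norm_eq_abs, sq_abs]
      refine mul_le_mul_of_nonneg_right ?_ (by positivity)
      have h2 := descFactorial_le_mul_refCoeff hm k
      have h3 := one_le_refCoeff l k
      rw [inv_pow, ← div_eq_mul_inv, div_le_iff₀ (by positivity)]
      refine h2.trans (mul_le_mul_of_nonneg_left ?_ (by positivity))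
      nlinarith
    obtain ⟨h, e⟩ := mem_normalSq_domain b l (R x) (x - R x) h1 fun k => by
      rw [inner_sub_right, hR.inner_basis_apply, add_zero]
      have := hne k
      push_cast
      field_simp
      rw [refCoeff]
      push_cast
      ring
    refine ⟨⟨trivial, h⟩, ?_⟩
    change R x + normalSq (lossOp b l) ⟨R x, h⟩ = x
    rw [e]
    abel
  · refine eq_of_inner_basis b fun k => ?_
    rw [hR.inner_basis_apply, add_zero, inner_basis_refOp, Complex.ofReal_inv, ← mul_assoc,
      inv_mul_cancel₀ (hne k), one_mul]

theorem IsBoundedInverse.comp_self {A : H →ₗ.[ℂ] H} {R : H →L[ℂ] H} (h : IsBoundedInverse A R) :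
    IsBoundedInverse (ppow A 2) (R * R) := by
  refine ⟨fun x => ?_, fun y => ?_⟩
  · obtain ⟨h1, e1⟩ := h.1 (R x)
    obtain ⟨h2, e2⟩ := h.1 x
    have h3 : R (R x) ∈ (ppow A 1).domain := ⟨trivial, h1⟩
    have e3 : ppow A 1 ⟨R (R x), h3⟩ = R x := e1
    have h4 : ppow A 1 ⟨R (R x), h3⟩ ∈ A.domain := by rwa [e3]
    refine ⟨⟨h3, h4⟩, ?_⟩
    change A ⟨ppow A 1 ⟨R (R x), h3⟩, h4⟩ = x
    exact (congrArg A (Subtype.ext e3)).trans e2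
  · obtain ⟨y, ⟨h1, h2⟩, h3⟩ := y
    change R (R (A ⟨A ⟨y, h2⟩, h3⟩)) = y
    rw [h.2]
    exact h.2 ⟨y, h2⟩

theorem IsBoundedInverse.unique {A : H →ₗ.[ℂ] H} {R R' : H →L[ℂ] H} (h : IsBoundedInverse A R)
    (h' : IsBoundedInverse A R') : R = R' := by
  ext x
  obtain ⟨h1, e1⟩ := h'.1 x
  conv_lhs => rw [← e1]
  exact h.2 ⟨R' x, h1⟩

theorem exists_isBoundedInverse_refOp_sq (l : ℕ) :
    ∃ R : H →L[ℂ] H, IsShift b 0 (fun k => ((refCoeff l k) ^ 2)⁻¹) R ∧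
      IsBoundedInverse (ppow (refOp b l) 2) R := by
  obtain ⟨R, hR⟩ := exists_isShift_diag b (fun k => (refCoeff l k)⁻¹) (C := 1) fun k => by
    have := one_le_refCoeff l k
    rw [abs_of_nonneg (by positivity)]
    exact inv_le_one_of_one_le₀ this
  refine ⟨R * R, (hR.mul_diag hR).congr fun k => ?_, (isBoundedInverse_refOp b l hR).comp_self⟩
  rw [sq, mul_inv]

/-! ### The truncated jump operator -/

/-- The weights of `L_n = P_n a^l P_n`. -/
def truncCoeff (l n k : ℕ) : ℝ := if k ≤ n then lossCoeff l k else 0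

theorem isShift_truncLossOp (l n : ℕ) : IsShift b l (truncCoeff l n) (truncLossOp b l n) where
  basis k := by
    change fockProj b n (lossOp b l (Submodule.inclusion (fockSpace_le_lossOp_domain b l n)
      ((fockSpace b n).orthogonalProjectionOnto (b k)))) = _
    have hP : (((fockSpace b n).orthogonalProjectionOnto (b k) : fockSpace b n) : H)
      = fockProj b n (b k) := rfl
    rw [fockProj_basis] at hP
    rw [truncCoeff]
    split_ifs at hP ⊢ with hk
    · obtain ⟨h, e⟩ := lossOp_basis b l k
      have : Submodule.inclusion (fockSpace_le_lossOp_domain b l n)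
          ((fockSpace b n).orthogonalProjectionOnto (b k)) = ⟨b k, h⟩ := Subtype.ext hP
      rw [this, e, map_smul, fockProj_basis, if_pos (by omega)]
    · have : (fockSpace b n).orthogonalProjectionOnto (b k) = 0 := Subtype.ext hP
      rw [this, map_zero, LinearPMap.map_zero, map_zero]
      simp
  vanish k hk := by
    rw [truncCoeff, lossCoeff_of_lt hk, ite_self]

end Loss

/-! ### The Kraus operators of the scheme -/

theorem truncCoeff_nonneg (l n k : ℕ) : 0 ≤ truncCoeff l n k := by
  rw [truncCoeff]
  split_ifs
  · exact lossCoeff_nonneg l k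
  · exact le_rfl

theorem truncCoeff_sub_le (l n : ℕ) {k : ℕ} (h : k ≤ n) (s : ℕ) :
    truncCoeff l n (k - s) ≤ truncCoeff l n k := by
  rw [truncCoeff, truncCoeff, if_pos h, if_pos (by omega)]
  exact Real.sqrt_le_sqrt (Nat.cast_le.2 (Nat.descFactorial_le l (Nat.sub_le k s)))

/-- The function `x ↦ (1 + x² / 4)^{-1/2}`. -/
def dampCoeff (x : ℝ) : ℝ := (√(1 + x ^ 2 / 4))⁻¹

theorem dampCoeff_pos (x : ℝ) : 0 < dampCoeff x := by
  unfold dampCoeff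
  positivity

theorem dampCoeff_sq (x : ℝ) : dampCoeff x ^ 2 * (1 + x ^ 2 / 4) = 1 := by
  rw [dampCoeff, inv_pow, Real.sq_sqrt (by positivity)]
  exact inv_mul_cancel₀ (by positivity)

theorem dampCoeff_le_one (x : ℝ) : dampCoeff x ≤ 1 := by
  have h1 := dampCoeff_sq x
  have h2 := dampCoeff_pos x
  nlinarith [sq_nonneg x, sq_nonneg (dampCoeff x * x)]

theorem one_sub_dampCoeff_le {x : ℝ} (hx : 0 ≤ x) : 1 - dampCoeff x ≤ x / 2 := by
  have h1 := dampCoeff_sq x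
  have h2 := dampCoeff_pos x
  have h3 := dampCoeff_le_one x
  have h4 : 1 ≤ dampCoeff x * (1 + x / 2) := by
    refine le_of_sq_le_sq ?_ (by positivity)
    nlinarith [mul_nonneg (sq_nonneg (dampCoeff x)) hx]
  nlinarith

theorem one_sub_dampCoeff_le_sq (x : ℝ) : 1 - dampCoeff x ≤ x ^ 2 / 4 := by
  have h1 := dampCoeff_sq x
  have h2 := dampCoeff_pos x
  have h3 := dampCoeff_le_one x
  nlinarith [mul_nonneg (sq_nonneg (dampCoeff x)) (sq_nonneg x), sq_nonneg x,
    mul_nonneg h2.le (sub_nonneg.2 h3)]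

section Scheme

variable (b : HilbertBasis ℕ ℂ H) (l n : ℕ)

/-- The truncated number-type operator `A_n = L_n† L_n`. -/
def truncNumOp : H →L[ℂ] H := star (truncLossOp b l n) * truncLossOp b l n

theorem isShift_truncNumOp : IsShift b 0 (fun k => truncCoeff l n k ^ 2) (truncNumOp b l n) :=
  ((isShift_truncLossOp b l n).star_mul (isShift_truncLossOp b l n)).congr fun _ => sq _

/-- The truncated reference operator `Λ_n = 1 + A_n`. -/
def truncRefOp : H →L[ℂ] H := 1 + truncNumOp b l n

theorem isShift_truncRefOp : IsShift b 0 (fun k => 1 + truncCoeff l n k ^ 2) (truncRefOp b l n) :=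
  IsShift.one.add (isShift_truncNumOp b l n)

/-- The weight `W_n = Λ_n²`. -/
def weightOp : H →L[ℂ] H := truncRefOp b l n * truncRefOp b l n

theorem isShift_weightOp :
    IsShift b 0 (fun k => (1 + truncCoeff l n k ^ 2) ^ 2) (weightOp b l n) :=
  ((isShift_truncRefOp b l n).mul_diag (isShift_truncRefOp b l n)).congr fun _ => sq _

theorem isShift_schemeS (Δt : ℝ) :
    IsShift b 0 (fun k => 1 + (Δt * truncCoeff l n k ^ 2) ^ 2 / 4) (schemeS b l n Δt) := by
  have h := (isShift_truncNumOp b l n).smul Δt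
  have h2 := IsShift.one.add ((h.mul_diag h).smul (1 / 4))
  have e : schemeS b l n Δt = 1 + ((1 / 4 : ℝ) : ℂ) •
      (((Δt : ℂ) • truncNumOp b l n) * ((Δt : ℂ) • truncNumOp b l n)) := by
    rw [schemeS, sq, truncNumOp]
    norm_num
  rw [e]
  exact h2.congr fun k => by ring

/-- The power `S^{-1/2}` of the functional calculus is the diagonal operator with entries
`(1 + x² / 4)^{-1/2}`, since the inverse of the latter is a positive square root of `S`. -/
theorem isShift_schemeS_rpow (Δt : ℝ) :
    IsShift b 0 (fun k => dampCoeff (Δt * truncCoeff l n k ^ 2))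
      (schemeS b l n Δt ^ (-(1 / 2) : ℝ)) := by
  have hS := isShift_schemeS b l n Δt
  obtain ⟨D, hD⟩ := exists_isShift_diag b (fun k => dampCoeff (Δt * truncCoeff l n k ^ 2)) (C := 1)
    fun k => by rw [abs_of_pos (dampCoeff_pos _)]; exact dampCoeff_le_one _
  obtain ⟨D', hD'⟩ := exists_isShift_diag b
    (fun k => √(dampCoeff (Δt * truncCoeff l n k ^ 2))) (C := 1)
    fun k => by
      rw [abs_of_nonneg (Real.sqrt_nonneg _), Real.sqrt_le_one]
      exact dampCoeff_le_one _
  -- `Q = S D` is the positive square root of `S`, and `D` is its inverse.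
  set Q := D * schemeS b l n Δt with hQ_def
  have hQ := hD.mul_diag hS
  rw [← hQ_def] at hQ
  have hDpos : 0 ≤ D := by
    have h1 := hD'.mul_self_nonneg
    rwa [(hD'.mul_diag hD').eq (hD.congr fun k => Real.mul_self_sqrt (dampCoeff_pos _).le)] at h1
  have hQD : Q * D = 1 := (hQ.mul_diag hD).eq (IsShift.one.congr fun k => by
    linear_combination dampCoeff_sq (Δt * truncCoeff l n k ^ 2))
  have hDQ : D * Q = 1 := (hD.mul_diag hQ).eq (IsShift.one.congr fun k => by
    linear_combination dampCoeff_sq (Δt * truncCoeff l n k ^ 2))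
  have hQQ : Q * Q = schemeS b l n Δt := (hQ.mul_diag hQ).eq (hS.congr fun k => by
    linear_combination (1 + (Δt * truncCoeff l n k ^ 2) ^ 2 / 4) *
      dampCoeff_sq (Δt * truncCoeff l n k ^ 2))
  have hQpos : 0 ≤ Q := by
    have h1 := star_left_conjugate_nonneg hDpos Q
    rwa [hQ.star_diag, mul_assoc, hDQ, mul_one] at h1
  have hSpos : IsStrictlyPositive (schemeS b l n Δt) := by
    refine IsUnit.isStrictlyPositive ?_ ?_
    · have hu : IsUnit Q := ⟨⟨Q, D, hQD, hDQ⟩, rfl⟩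
      rw [← hQQ]
      exact hu.mul hu
    · rw [← hQQ]
      exact hQ.mul_self_nonneg
  have h1 := CFC.rpow_neg_mul_rpow (1 / 2) hSpos
  rw [← CFC.sqrt_eq_rpow, CFC.sqrt_unique hQQ hQpos] at h1
  have h2 : schemeS b l n Δt ^ (-(1 / 2) : ℝ) = D := by
    calc schemeS b l n Δt ^ (-(1 / 2) : ℝ) = schemeS b l n Δt ^ (-(1 / 2) : ℝ) * Q * D := by
          rw [mul_assoc, hQD, mul_one]
      _ = D := by rw [h1, one_mul]
  rw [h2]
  exact hD

/-- The diagonal entries of the first Kraus operator. -/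
def krausCoeff (x : ℝ) : ℝ := dampCoeff x * (1 - x / 2)

theorem isShift_schemeM0 (Δt : ℝ) :
    IsShift b 0 (fun k => krausCoeff (Δt * truncCoeff l n k ^ 2)) (schemeM0 b l n Δt) := by
  refine ((IsShift.one.sub ((isShift_truncNumOp b l n).smul (Δt / 2))).mul_diag
    (isShift_schemeS_rpow b l n Δt)).congr fun k => ?_
  rw [krausCoeff]
  ring

/-- `L_n S^{-1/2}`, the second Kraus operator without its factor `√Δt`. -/
def dampedLossOp (Δt : ℝ) : H →L[ℂ] H := truncLossOp b l n * schemeS b l n Δt ^ (-(1 / 2) : ℝ)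

theorem isShift_dampedLossOp (Δt : ℝ) :
    IsShift b l (fun k => dampCoeff (Δt * truncCoeff l n k ^ 2) * truncCoeff l n k)
      (dampedLossOp b l n Δt) :=
  (isShift_truncLossOp b l n).mul_diag (isShift_schemeS_rpow b l n Δt)

theorem schemeM1_eq (Δt : ℝ) : schemeM1 b l n Δt = (√Δt : ℂ) • dampedLossOp b l n Δt :=
  smul_mul_assoc _ _ _

theorem isShift_schemeM1 (Δt : ℝ) :
    IsShift b l (fun k => √Δt * (dampCoeff (Δt * truncCoeff l n k ^ 2) * truncCoeff l n k))
      (schemeM1 b l n Δt) := by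
  rw [schemeM1_eq]
  exact (isShift_dampedLossOp b l n Δt).smul _

theorem krausCoeff_sq_add {Δt : ℝ} (hΔt : 0 ≤ Δt) (c : ℝ) :
    krausCoeff (Δt * c ^ 2) ^ 2 + (√Δt * (dampCoeff (Δt * c ^ 2) * c)) ^ 2 = 1 := by
  rw [krausCoeff, mul_pow (√Δt), Real.sq_sqrt hΔt]
  linear_combination dampCoeff_sq (Δt * c ^ 2)

theorem norm_sq_schemeM0_add_schemeM1 {Δt : ℝ} (hΔt : 0 ≤ Δt) (v : H) :
    ‖schemeM0 b l n Δt v‖ ^ 2 + ‖schemeM1 b l n Δt v‖ ^ 2 = ‖v‖ ^ 2 := by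
  have h := ((isShift_schemeM0 b l n Δt).hasSum_norm_sq v).add
    ((isShift_schemeM1 b l n Δt).hasSum_norm_sq v)
  refine h.unique ?_
  have h2 := hasSum_norm_sq b v
  simp_rw [← add_mul, krausCoeff_sq_add hΔt, one_mul]
  exact h2

/-- Weighted stability of the scheme. It holds because the jumps lower the photon number, while
the weight increases with it on the truncated space. -/
theorem norm_sq_weightOp_schemeM0_add_schemeM1_le {Δt : ℝ} (hΔt : 0 ≤ Δt) (v : H) :
    ‖weightOp b l n (schemeM0 b l n Δt v)‖ ^ 2 + ‖weightOp b l n (schemeM1 b l n Δt v)‖ ^ 2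
      ≤ ‖weightOp b l n v‖ ^ 2 := by
  have hW := isShift_weightOp b l n
  refine hasSum_le (fun k => ?_) (((hW.mul (isShift_schemeM0 b l n Δt)).hasSum_norm_sq v).add
    ((hW.mul (isShift_schemeM1 b l n Δt)).hasSum_norm_sq v)) (hW.hasSum_norm_sq v)
  rw [← add_mul]
  refine mul_le_mul_of_nonneg_right ?_ (by positivity)
  rw [mul_pow, mul_pow _ ((1 + truncCoeff l n (k - l) ^ 2) ^ 2), Nat.sub_zero]
  have h1 := krausCoeff_sq_add hΔt (truncCoeff l n k)
  rcases le_or_gt k n with hk | hk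
  · have h2 : ((1 + truncCoeff l n (k - l) ^ 2) ^ 2) ^ 2 ≤ ((1 + truncCoeff l n k ^ 2) ^ 2) ^ 2 := by
      have := truncCoeff_nonneg l n (k - l)
      gcongr
      exact truncCoeff_sub_le l n hk l
    calc _ ≤ krausCoeff (Δt * truncCoeff l n k ^ 2) ^ 2 * ((1 + truncCoeff l n k ^ 2) ^ 2) ^ 2
          + (√Δt * (dampCoeff (Δt * truncCoeff l n k ^ 2) * truncCoeff l n k)) ^ 2
            * ((1 + truncCoeff l n k ^ 2) ^ 2) ^ 2 := by gcongr
      _ = ((1 + truncCoeff l n k ^ 2) ^ 2) ^ 2 := by rw [← add_mul, h1, one_mul]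
  · have h0 : truncCoeff l n k = 0 := if_neg (by omega)
    rw [h0] at h1 ⊢
    simp only [mul_zero, ne_eq, OfNat.ofNat_ne_zero, not_false_eq_true, zero_pow, add_zero] at h1 ⊢
    rw [h1]
    simp

/-! ### Consistency of the scheme on weighted vectors -/

variable {Δt : ℝ} (hΔt : 0 ≤ Δt) (v : H)

theorem norm_le_weightOp : ‖v‖ ≤ ‖weightOp b l n v‖ := by
  have := IsShift.one.norm_apply_le (isShift_weightOp b l n) zero_le_one (fun k => ?_) v
  · simpa using this
  · rw [abs_one, one_mul, abs_of_nonneg (by positivity)]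
    exact one_le_pow₀ (by nlinarith [sq_nonneg (truncCoeff l n k)])

include hΔt in
theorem norm_schemeM0_sub_one_le :
    ‖(schemeM0 b l n Δt - 1) v‖ ≤ Δt * ‖weightOp b l n v‖ := by
  refine ((isShift_schemeM0 b l n Δt).sub IsShift.one).norm_apply_le (isShift_weightOp b l n)
    hΔt (fun k => ?_) v
  set c := truncCoeff l n k
  have hx : 0 ≤ Δt * c ^ 2 := by positivity
  have h1 := one_sub_dampCoeff_le hx
  have h2 := dampCoeff_le_one (Δt * c ^ 2)
  have h3 := dampCoeff_pos (Δt * c ^ 2)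
  rw [abs_of_nonneg (show 0 ≤ (1 + c ^ 2) ^ 2 by positivity)]
  have h4 : Δt * c ^ 2 ≤ Δt * (1 + c ^ 2) ^ 2 :=
    mul_le_mul_of_nonneg_left (by nlinarith [sq_nonneg c, sq_nonneg (c ^ 2)]) hΔt
  refine le_trans ?_ h4
  rw [krausCoeff, abs_le]
  constructor <;> nlinarith

include hΔt in
theorem norm_schemeM0_sub_one_add_le :
    ‖(schemeM0 b l n Δt - 1 + ((Δt / 2 : ℝ) : ℂ) • truncNumOp b l n) v‖
      ≤ Δt ^ 2 * ‖weightOp b l n v‖ := by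
  refine (((isShift_schemeM0 b l n Δt).sub IsShift.one).add
    ((isShift_truncNumOp b l n).smul (Δt / 2))).norm_apply_le (isShift_weightOp b l n)
    (by positivity) (fun k => ?_) v
  set c := truncCoeff l n k
  have hx : 0 ≤ Δt * c ^ 2 := by positivity
  have h1 := one_sub_dampCoeff_le hx
  have h1' := one_sub_dampCoeff_le_sq (Δt * c ^ 2)
  have h2 := dampCoeff_le_one (Δt * c ^ 2)
  rw [abs_of_nonneg (show 0 ≤ (1 + c ^ 2) ^ 2 by positivity)]
  have h4 : (Δt * c ^ 2) ^ 2 ≤ Δt ^ 2 * (1 + c ^ 2) ^ 2 := by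
    rw [mul_pow]
    gcongr
    nlinarith [sq_nonneg c]
  refine le_trans ?_ h4
  have e : krausCoeff (Δt * c ^ 2) - 1 + Δt / 2 * c ^ 2
      = -((1 - dampCoeff (Δt * c ^ 2)) * (1 - Δt * c ^ 2 / 2)) := by
    rw [krausCoeff]
    ring
  rw [e, abs_le]
  constructor <;> nlinarith

theorem norm_truncLossOp_le_weightOp : ‖truncLossOp b l n v‖ ≤ ‖weightOp b l n v‖ := by
  have := (isShift_truncLossOp b l n).norm_apply_le (isShift_weightOp b l n) zero_le_one
    (fun k => ?_) v
  · simpa using this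
  · have := truncCoeff_nonneg l n k
    rw [abs_of_nonneg this, one_mul, abs_of_nonneg (by positivity)]
    nlinarith [sq_nonneg (truncCoeff l n k - 1), sq_nonneg (truncCoeff l n k ^ 2)]

theorem norm_dampedLossOp_le_weightOp : ‖dampedLossOp b l n Δt v‖ ≤ ‖weightOp b l n v‖ := by
  refine le_trans ?_ (norm_truncLossOp_le_weightOp b l n v)
  have := (isShift_dampedLossOp b l n Δt).norm_apply_le (isShift_truncLossOp b l n) zero_le_one
    (fun k => ?_) v
  · simpa using this
  · rw [abs_mul, abs_of_pos (dampCoeff_pos _)]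
    exact mul_le_mul_of_nonneg_right (dampCoeff_le_one _) (abs_nonneg _)

include hΔt in
theorem norm_dampedLossOp_sub_le :
    ‖(dampedLossOp b l n Δt - truncLossOp b l n) v‖ ≤ Δt * ‖weightOp b l n v‖ := by
  refine ((isShift_dampedLossOp b l n Δt).sub (isShift_truncLossOp b l n)).norm_apply_le
    (isShift_weightOp b l n) hΔt (fun k => ?_) v
  set c := truncCoeff l n k with hc
  have hc0 : 0 ≤ c := truncCoeff_nonneg l n k
  have hx : 0 ≤ Δt * c ^ 2 := by positivity
  have h1 := one_sub_dampCoeff_le hx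
  have h2 := dampCoeff_le_one (Δt * c ^ 2)
  rw [abs_of_nonneg (show 0 ≤ (1 + c ^ 2) ^ 2 by positivity), abs_sub_comm,
    abs_of_nonneg (by nlinarith)]
  calc c - dampCoeff (Δt * c ^ 2) * c = (1 - dampCoeff (Δt * c ^ 2)) * c := by ring
    _ ≤ Δt * c ^ 2 / 2 * c := by gcongr
    _ = Δt * (c ^ 2 / 2 * c) := by ring
    _ ≤ Δt * (1 + c ^ 2) ^ 2 := by
      gcongr
      nlinarith [sq_nonneg (c - 1), mul_nonneg hc0 (sq_nonneg (c - 1)), sq_nonneg (c ^ 2 - c)]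

end Scheme

/-! ### One-parameter semigroups in a Banach algebra -/

section Flow

variable {𝔸 : Type*} [NormedRing 𝔸] [NormedAlgebra ℂ 𝔸] [CompleteSpace 𝔸]

/-- The one-parameter semigroup `exp (t a)` for real times `t`. -/
def expFlow (a : 𝔸) (t : ℝ) : 𝔸 := NormedSpace.exp ((t : ℂ) • a)

theorem expFlow_zero (a : 𝔸) : expFlow a 0 = 1 := by
  rw [expFlow, Complex.ofReal_zero, zero_smul, NormedSpace.exp_zero]

theorem expFlow_add (a : 𝔸) (s t : ℝ) : expFlow a (s + t) = expFlow a s * expFlow a t := by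
  let : NormedAlgebra ℚ 𝔸 := .restrictScalars ℚ ℂ 𝔸
  rw [expFlow, Complex.ofReal_add, add_smul, NormedSpace.exp_add_of_commute]
  · rfl
  · exact ((Commute.refl _).smul_left _).smul_right _

theorem hasDerivAt_map_expFlow {E : Type*} [NormedAddCommGroup E] [NormedSpace ℂ E] (a : 𝔸)
    (φ : 𝔸 →L[ℂ] E) (t : ℝ) :
    HasDerivAt (fun t => φ (expFlow a t)) (φ (a * expFlow a t)) t :=
  (φ.hasFDerivAt.comp_hasDerivAt _ (hasDerivAt_exp_smul_const' a (t : ℂ))).scomp t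
    Complex.ofRealCLM.hasDerivAt |>.congr_deriv (one_smul _ _)

theorem expFlow_mul_comm (a : 𝔸) (t : ℝ) : a * expFlow a t = expFlow a t * a := by
  let : NormedAlgebra ℚ 𝔸 := .restrictScalars ℚ ℂ 𝔸
  exact (((Commute.refl a).smul_right (t : ℂ)).exp_right).eq

theorem semiconjBy_expFlow {x a c : 𝔸} (h : SemiconjBy x a c) (t : ℝ) :
    SemiconjBy x (expFlow a t) (expFlow c t) := by
  let : NormedAlgebra ℚ 𝔸 := .restrictScalars ℚ ℂ 𝔸
  refine SemiconjBy.exp_right ?_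
  rw [SemiconjBy, mul_smul_comm, smul_mul_assoc, h.eq]

end Flow

/-! ### The truncated Heisenberg dynamics -/

section Dynamics

variable (b : HilbertBasis ℕ ℂ H) (l n : ℕ)

/-- The bounded Heisenberg generator `X ↦ L_n† X L_n - (A_n X + X A_n) / 2` on `B(H)`. -/
def truncGen : (H →L[ℂ] H) →L[ℂ] (H →L[ℂ] H) :=
  ContinuousLinearMap.mulLeftRight ℂ (H →L[ℂ] H) (star (truncLossOp b l n)) (truncLossOp b l n)
    - (1 / 2 : ℂ) • (ContinuousLinearMap.mulLeftRight ℂ (H →L[ℂ] H) (truncNumOp b l n) 1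
      + ContinuousLinearMap.mulLeftRight ℂ (H →L[ℂ] H) 1 (truncNumOp b l n))

theorem truncGen_apply (X : H →L[ℂ] H) :
    truncGen b l n X = star (truncLossOp b l n) * X * truncLossOp b l n
      - (1 / 2 : ℂ) • (truncNumOp b l n * X + X * truncNumOp b l n) := by
  change _ * X * _ - (1 / 2 : ℂ) • (truncNumOp b l n * X * 1 + 1 * X * truncNumOp b l n) = _
  rw [mul_one, one_mul]

theorem inner_star_mul (A B : H →L[ℂ] H) (v u : H) :
    inner ℂ v ((star A * B) u) = inner ℂ (A v) (B u) := by
  rw [mul_apply_eq_comp, ContinuousLinearMap.star_eq_adjoint,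
    ContinuousLinearMap.adjoint_inner_right]

theorem inner_truncGen (X : H →L[ℂ] H) (v u : H) :
    inner ℂ v (truncGen b l n X u)
      = inner ℂ (truncLossOp b l n v) (X (truncLossOp b l n u))
        - (1 / 2 : ℂ) * (inner ℂ (truncNumOp b l n v) (X u)
          + inner ℂ v (X (truncNumOp b l n u))) := by
  rw [truncGen_apply, sub_apply, inner_sub_right, mul_assoc, inner_star_mul, smul_apply,
    inner_smul_right, add_apply, inner_add_right]
  have h := inner_star_mul (truncNumOp b l n) X v u
  rw [(isShift_truncNumOp b l n).star_diag] at h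
  rw [h]
  rfl

/-- The Heisenberg semigroup `exp (t 𝓛_n)` of the truncated equation, on all of `B(H)`. -/
def truncEvol (t : ℝ) : (H →L[ℂ] H) →L[ℂ] (H →L[ℂ] H) := expFlow (truncGen b l n) t

theorem truncEvol_zero : truncEvol b l n 0 = 1 := expFlow_zero _

theorem truncEvol_add (s t : ℝ) :
    truncEvol b l n (s + t) = truncEvol b l n s * truncEvol b l n t := expFlow_add _ s t

theorem hasDerivAt_map_truncEvol {E : Type*} [NormedAddCommGroup E] [NormedSpace ℂ E]
    (X : H →L[ℂ] H) (φ : (H →L[ℂ] H) →L[ℂ] E) (t : ℝ) :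
    HasDerivAt (fun t => φ (truncEvol b l n t X)) (φ (truncGen b l n (truncEvol b l n t X))) t :=
  hasDerivAt_map_expFlow (truncGen b l n) (φ ∘L ContinuousLinearMap.apply ℂ (H →L[ℂ] H) X) t

theorem hasDerivAt_truncEvol (X : H →L[ℂ] H) (t : ℝ) :
    HasDerivAt (fun t => truncEvol b l n t X) (truncGen b l n (truncEvol b l n t X)) t :=
  hasDerivAt_map_truncEvol b l n X (.id ℂ _) t

theorem hasDerivAt_inner_truncEvol (X : H →L[ℂ] H) (Φ : (H →L[ℂ] H) →L[ℂ] (H →L[ℂ] H))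
    (v u : H) (t : ℝ) :
    HasDerivAt (fun t => inner ℂ v (Φ (truncEvol b l n t X) u))
      (inner ℂ v (Φ (truncGen b l n (truncEvol b l n t X)) u)) t :=
  hasDerivAt_map_truncEvol b l n X ((innerSL ℂ v) ∘L (ContinuousLinearMap.apply ℂ H u) ∘L Φ) t

theorem continuous_truncEvol_apply (X : H →L[ℂ] H) : Continuous fun t => truncEvol b l n t X :=
  continuous_iff_continuousAt.2 fun t => (hasDerivAt_truncEvol b l n X t).continuousAt

/-- The dual `X ↦ M̃₀† X M̃₀ + M̃₁† X M̃₁` of one step of the scheme. -/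
def schemeDual (Δt : ℝ) : (H →L[ℂ] H) →L[ℂ] (H →L[ℂ] H) :=
  ContinuousLinearMap.mulLeftRight ℂ (H →L[ℂ] H) (star (schemeM0 b l n Δt)) (schemeM0 b l n Δt)
    + ContinuousLinearMap.mulLeftRight ℂ (H →L[ℂ] H) (star (schemeM1 b l n Δt))
      (schemeM1 b l n Δt)

theorem schemeDual_apply (Δt : ℝ) (X : H →L[ℂ] H) :
    schemeDual b l n Δt X = star (schemeM0 b l n Δt) * X * schemeM0 b l n Δt
      + star (schemeM1 b l n Δt) * X * schemeM1 b l n Δt := rfl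

theorem inner_schemeDual (Δt : ℝ) (X : H →L[ℂ] H) (v u : H) :
    inner ℂ v (schemeDual b l n Δt X u)
      = inner ℂ (schemeM0 b l n Δt v) (X (schemeM0 b l n Δt u))
        + inner ℂ (schemeM1 b l n Δt v) (X (schemeM1 b l n Δt u)) := by
  rw [schemeDual_apply, add_apply, inner_add_right, mul_assoc, mul_assoc, inner_star_mul,
    inner_star_mul]
  rfl

/-! ### Weighted form bounds -/

/-- The sesquilinear form of `Z` is bounded by `K` relative to the weight `Y`, that is,
`‖Y⁻¹ Z Y⁻¹‖ ≤ K` for self-adjoint invertible `Y`. -/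
def FormBound (Y : H →L[ℂ] H) (K : ℝ) (Z : H →L[ℂ] H) : Prop :=
  ∀ v u : H, ‖inner ℂ v (Z u)‖ ≤ K * (‖Y v‖ * ‖Y u‖)

theorem formBound_one (Z : H →L[ℂ] H) : FormBound 1 ‖Z‖ Z := fun v u => by
  calc _ ≤ ‖v‖ * ‖Z u‖ := norm_inner_le_norm _ _
    _ ≤ ‖v‖ * (‖Z‖ * ‖u‖) := by gcongr; exact Z.le_opNorm u
    _ = ‖Z‖ * (‖(1 : H →L[ℂ] H) v‖ * ‖(1 : H →L[ℂ] H) u‖) := by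
      simp only [one_apply_eq_self]; ring

theorem FormBound.norm_le {K : ℝ} {Z : H →L[ℂ] H} (hK : 0 ≤ K) (h : FormBound 1 K Z) :
    ‖Z‖ ≤ K := by
  refine ContinuousLinearMap.opNorm_le_bound _ hK fun u => ?_
  have h1 := h (Z u) u
  rw [inner_self_eq_norm_sq_to_K, norm_pow] at h1
  simp only [one_apply_eq_self, RCLike.norm_ofReal, abs_norm] at h1
  rcases (norm_nonneg (Z u)).eq_or_lt with h0 | h0
  · rw [← h0]; positivity
  · nlinarith

variable {b l n} in
theorem FormBound.truncGen {Y Y' : H →L[ℂ] H} {K : ℝ} {Z : H →L[ℂ] H} (hK : 0 ≤ K)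
    (hZ : FormBound Y K Z) (h1 : ∀ v, ‖Y v‖ ≤ ‖Y' v‖)
    (h2 : ∀ v, ‖Y (truncLossOp b l n v)‖ ≤ ‖Y' v‖)
    (h3 : ∀ v, ‖Y (truncNumOp b l n v)‖ ≤ ‖Y' v‖) :
    FormBound Y' (2 * K) (PhotonLoss.truncGen b l n Z) := fun v u => by
  rw [inner_truncGen]
  have e1 : ‖inner ℂ (truncLossOp b l n v) (Z (truncLossOp b l n u))‖ ≤ K * (‖Y' v‖ * ‖Y' u‖) :=
    (hZ _ _).trans (by gcongr; exacts [h2 v, h2 u])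
  have e2 : ‖inner ℂ (truncNumOp b l n v) (Z u)‖ ≤ K * (‖Y' v‖ * ‖Y' u‖) :=
    (hZ _ _).trans (by gcongr; exacts [h3 v, h1 u])
  have e3 : ‖inner ℂ v (Z (truncNumOp b l n u))‖ ≤ K * (‖Y' v‖ * ‖Y' u‖) :=
    (hZ _ _).trans (by gcongr; exacts [h1 v, h3 u])
  refine (norm_sub_le _ _).trans ?_
  rw [norm_mul]
  have e4 := norm_add_le (inner ℂ (truncNumOp b l n v) (Z u)) (inner ℂ v (Z (truncNumOp b l n u)))
  have e5 : ‖(1 / 2 : ℂ)‖ = 1 / 2 := by norm_num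
  rw [e5]
  linarith

theorem norm_le_truncRefOp (v : H) : ‖v‖ ≤ ‖truncRefOp b l n v‖ := by
  have := IsShift.one.norm_apply_le (isShift_truncRefOp b l n) zero_le_one (fun k => ?_) v
  · simpa using this
  · rw [abs_one, one_mul, abs_of_nonneg (by positivity)]
    nlinarith [sq_nonneg (truncCoeff l n k)]

theorem norm_truncLossOp_le_truncRefOp (v : H) :
    ‖truncLossOp b l n v‖ ≤ ‖truncRefOp b l n v‖ := by
  have := (isShift_truncLossOp b l n).norm_apply_le (isShift_truncRefOp b l n) zero_le_one
    (fun k => ?_) v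
  · simpa using this
  · rw [one_mul, abs_of_nonneg (truncCoeff_nonneg l n k), abs_of_nonneg (by positivity)]
    nlinarith [sq_nonneg (truncCoeff l n k - 1), sq_nonneg (truncCoeff l n k)]

theorem norm_truncNumOp_le_truncRefOp (v : H) :
    ‖truncNumOp b l n v‖ ≤ ‖truncRefOp b l n v‖ := by
  have := (isShift_truncNumOp b l n).norm_apply_le (isShift_truncRefOp b l n) zero_le_one
    (fun k => ?_) v
  · simpa using this
  · rw [one_mul, abs_of_nonneg (by positivity), abs_of_nonneg (by positivity)]
    linarith

theorem norm_truncRefOp_truncLossOp_le (v : H) :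
    ‖truncRefOp b l n (truncLossOp b l n v)‖ ≤ ‖weightOp b l n v‖ := by
  have := ((isShift_truncRefOp b l n).mul (isShift_truncLossOp b l n)).norm_apply_le
    (isShift_weightOp b l n) zero_le_one (fun k => ?_) v
  · simpa using this
  · have hc := truncCoeff_nonneg l n k
    rw [one_mul, abs_of_nonneg (by positivity), abs_of_nonneg (by positivity), sq (1 + _)]
    rcases le_or_gt k n with hk | hk
    · have := truncCoeff_sub_le l n hk l
      have h0 := truncCoeff_nonneg l n (k - l)
      gcongr
      nlinarith [sq_nonneg (truncCoeff l n k - 1)]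
    · rw [show truncCoeff l n k = 0 from if_neg (by omega)]
      norm_num

theorem norm_truncRefOp_truncNumOp_le (v : H) :
    ‖truncRefOp b l n (truncNumOp b l n v)‖ ≤ ‖weightOp b l n v‖ := by
  have := ((isShift_truncRefOp b l n).mul_diag (isShift_truncNumOp b l n)).norm_apply_le
    (isShift_weightOp b l n) zero_le_one (fun k => ?_) v
  · simpa using this
  · rw [one_mul, abs_of_nonneg (by positivity), abs_of_nonneg (by positivity), sq (1 + _)]
    gcongr
    linarith

theorem norm_truncRefOp_le_weightOp (v : H) :
    ‖truncRefOp b l n v‖ ≤ ‖weightOp b l n v‖ :=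
  norm_le_truncRefOp b l n (truncRefOp b l n v)

/-- Two applications of the generator cost two powers of `Λ_n` on each side. -/
theorem formBound_truncGen_truncGen (Z : H →L[ℂ] H) :
    FormBound (weightOp b l n) (4 * ‖Z‖) (truncGen b l n (truncGen b l n Z)) := by
  have h1 := (formBound_one Z).truncGen (b := b) (l := l) (n := n) (Y' := truncRefOp b l n)
    (norm_nonneg _) (norm_le_truncRefOp b l n) (norm_truncLossOp_le_truncRefOp b l n)
    (norm_truncNumOp_le_truncRefOp b l n)
  have h2 := h1.truncGen (b := b) (l := l) (n := n) (Y' := weightOp b l n) (by positivity)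
    (norm_truncRefOp_le_weightOp b l n) (norm_truncRefOp_truncLossOp_le b l n)
    (norm_truncRefOp_truncNumOp_le b l n)
  rwa [← mul_assoc, show (2 * 2 : ℝ) = 4 by norm_num] at h2

/-! ### The error of the scheme on the truncated space -/

variable {Δt : ℝ} (hΔt : 0 ≤ Δt)

include hΔt in
/-- Second order Taylor formula for the truncated dynamics, tested against weighted vectors; the
constant does not depend on `n`. -/
theorem formBound_truncEvol_sub {X : H →L[ℂ] H} {B : ℝ}
    (hB : ∀ s ∈ Set.Icc 0 Δt, ‖truncEvol b l n s X‖ ≤ B) :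
    FormBound (weightOp b l n) (4 * B * Δt ^ 2)
      (truncEvol b l n Δt X - X - (Δt : ℂ) • truncGen b l n X) := fun v u => by
  set w := ‖weightOp b l n v‖ * ‖weightOp b l n u‖ with hw
  have hd (t : ℝ) := hasDerivAt_inner_truncEvol b l n X 1 v u t
  have hd2 (t : ℝ) := hasDerivAt_inner_truncEvol b l n X (truncGen b l n) v u t
  have h0 : truncEvol b l n 0 X = X := by rw [truncEvol_zero]; rfl
  have step1 : ∀ t ∈ Set.Icc (0 : ℝ) Δt,
      ‖inner ℂ v (truncGen b l n (truncEvol b l n t X) u)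
        - inner ℂ v (truncGen b l n (truncEvol b l n 0 X) u)‖ ≤ 4 * B * w * (t - 0) := by
    refine norm_image_sub_le_of_norm_deriv_le_segment'
      (fun t _ => (hd2 t).hasDerivWithinAt) fun t ht => ?_
    refine (formBound_truncGen_truncGen b l n _ v u).trans ?_
    gcongr
    exact hB t ⟨ht.1, ht.2.le⟩
  have hB0 : 0 ≤ B := (norm_nonneg _).trans (hB 0 ⟨le_rfl, hΔt⟩)
  have step2 := norm_image_sub_le_of_norm_deriv_le_segment' (C := 4 * B * w * Δt)
    (f := fun t : ℝ => inner ℂ v (truncEvol b l n t X u) - (t : ℂ) * inner ℂ v (truncGen b l n X u))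
    (f' := fun t => inner ℂ v (truncGen b l n (truncEvol b l n t X) u)
        - inner ℂ v (truncGen b l n X u)) (a := 0) (b := Δt)
    (fun t _ => ((hd t).sub (by
      simpa using (Complex.ofRealCLM.hasDerivAt (x := t)).mul_const
        (inner ℂ v (truncGen b l n X u)))).hasDerivWithinAt) (fun t ht => by
      have h1 := step1 t ⟨ht.1, ht.2.le⟩
      rw [h0] at h1
      refine h1.trans ?_
      have := ht.2.le
      gcongr
      linarith) Δt ⟨hΔt, le_rfl⟩
  rw [h0] at step2
  rw [sub_apply, sub_apply, smul_apply, inner_sub_right, inner_sub_right, inner_smul_right]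
  refine le_trans (le_of_eq ?_) (step2.trans (le_of_eq ?_))
  · congr 1
    push_cast
    ring
  · ring

include hΔt in
/-- One step of the scheme agrees with the Taylor polynomial `X + Δt 𝓛_n X` up to second order on
weighted vectors, uniformly in `n`. -/
theorem formBound_schemeDual_sub (X : H →L[ℂ] H) :
    FormBound (weightOp b l n) (5 * ‖X‖ * Δt ^ 2)
      (schemeDual b l n Δt X - X - (Δt : ℂ) • truncGen b l n X) := fun v u => by
  set W := weightOp b l n
  set A := truncNumOp b l n
  set L := truncLossOp b l n
  set D := dampedLossOp b l n Δt
  set Q := schemeM0 b l n Δt - 1 with hQ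
  set R := Q + ((Δt / 2 : ℝ) : ℂ) • A with hR
  set N := D - L with hN
  have hX (x y : H) : ‖inner ℂ x (X y)‖ ≤ ‖X‖ * (‖x‖ * ‖y‖) := formBound_one X x y
  have eM (x : H) : schemeM0 b l n Δt x = x + Q x := by rw [hQ]; simp
  have eR (x : H) : R x = Q x + ((Δt / 2 : ℝ) : ℂ) • A x := rfl
  have eD (x : H) : D x = L x + N x := by rw [hN]; simp
  have hs : (√Δt : ℂ) * √Δt = Δt := by rw [← Complex.ofReal_mul, Real.mul_self_sqrt hΔt]
  have key : inner ℂ v ((schemeDual b l n Δt X - X - (Δt : ℂ) • truncGen b l n X) u)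
      = inner ℂ (R v) (X u) + inner ℂ v (X (R u)) + inner ℂ (Q v) (X (Q u))
        + Δt * (inner ℂ (N v) (X (D u)) + inner ℂ (L v) (X (N u))) := by
    rw [sub_apply, sub_apply, smul_apply, inner_sub_right, inner_sub_right, inner_smul_right,
      inner_schemeDual, inner_truncGen, eM, eM, schemeM1_eq, smul_apply, smul_apply, eR, eR]
    change _ + inner ℂ ((√Δt : ℂ) • D v) (X ((√Δt : ℂ) • D u)) - _ - _ * (_ - _ * _) = _
    rw [eD, eD]
    simp only [map_add, map_smul, inner_add_left, inner_add_right, inner_smul_left,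
      inner_smul_right, Complex.conj_ofReal]
    push_cast
    linear_combination (inner ℂ (L v) (X (L u)) + inner ℂ (N v) (X (L u))
      + inner ℂ (L v) (X (N u)) + inner ℂ (N v) (X (N u))) * hs
  rw [key]
  have hQb (x : H) : ‖Q x‖ ≤ Δt * ‖W x‖ := norm_schemeM0_sub_one_le b l n hΔt x
  have hRb (x : H) : ‖R x‖ ≤ Δt ^ 2 * ‖W x‖ := norm_schemeM0_sub_one_add_le b l n hΔt x
  have hNb (x : H) : ‖N x‖ ≤ Δt * ‖W x‖ := norm_dampedLossOp_sub_le b l n hΔt x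
  have hDb (x : H) : ‖D x‖ ≤ ‖W x‖ := norm_dampedLossOp_le_weightOp b l n x
  have hLb (x : H) : ‖L x‖ ≤ ‖W x‖ := norm_truncLossOp_le_weightOp b l n x
  have h1b (x : H) : ‖x‖ ≤ ‖W x‖ := norm_le_weightOp b l n x
  have t1 : ‖inner ℂ (R v) (X u)‖ ≤ ‖X‖ * ((Δt ^ 2 * ‖W v‖) * ‖W u‖) :=
    (hX _ _).trans (by gcongr; exacts [hRb v, h1b u])
  have t2 : ‖inner ℂ v (X (R u))‖ ≤ ‖X‖ * (‖W v‖ * (Δt ^ 2 * ‖W u‖)) :=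
    (hX _ _).trans (by gcongr; exacts [h1b v, hRb u])
  have t3 : ‖inner ℂ (Q v) (X (Q u))‖ ≤ ‖X‖ * ((Δt * ‖W v‖) * (Δt * ‖W u‖)) :=
    (hX _ _).trans (by gcongr; exacts [hQb v, hQb u])
  have t4 : ‖inner ℂ (N v) (X (D u))‖ ≤ ‖X‖ * ((Δt * ‖W v‖) * ‖W u‖) :=
    (hX _ _).trans (by gcongr; exacts [hNb v, hDb u])
  have t5 : ‖inner ℂ (L v) (X (N u))‖ ≤ ‖X‖ * (‖W v‖ * (Δt * ‖W u‖)) :=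
    (hX _ _).trans (by gcongr; exacts [hLb v, hNb u])
  have t6 : ‖(Δt : ℂ) * (inner ℂ (N v) (X (D u)) + inner ℂ (L v) (X (N u)))‖
      ≤ Δt * (‖X‖ * ((Δt * ‖W v‖) * ‖W u‖) + ‖X‖ * (‖W v‖ * (Δt * ‖W u‖))) := by
    rw [norm_mul, Complex.norm_real, Real.norm_of_nonneg hΔt]
    gcongr
    exact (norm_add_le _ _).trans (add_le_add t4 t5)
  refine (norm_add_le _ _).trans ((add_le_add ((norm_add₃_le).trans
    (add_le_add (add_le_add t1 t2) t3)) t6).trans (le_of_eq ?_))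
  ring

theorem mul_add_mul_le_of_sq {a b c d x y : ℝ} (hx : 0 ≤ x) (hy : 0 ≤ y)
    (h1 : a ^ 2 + b ^ 2 ≤ x ^ 2) (h2 : c ^ 2 + d ^ 2 ≤ y ^ 2) : a * c + b * d ≤ x * y := by
  refine le_of_sq_le_sq ?_ (by positivity)
  have h3 : (a ^ 2 + b ^ 2) * (c ^ 2 + d ^ 2) ≤ x ^ 2 * y ^ 2 :=
    mul_le_mul h1 h2 (by positivity) (by positivity)
  nlinarith [sq_nonneg (a * d - b * c)]

variable {b l n} in
include hΔt in
/-- The dual scheme is a contraction for the weighted form norm. -/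
theorem FormBound.schemeDual {K : ℝ} {Z : H →L[ℂ] H} (hK : 0 ≤ K)
    (hZ : FormBound (weightOp b l n) K Z) :
    FormBound (weightOp b l n) K (PhotonLoss.schemeDual b l n Δt Z) := fun v u => by
  rw [inner_schemeDual]
  refine (norm_add_le _ _).trans ((add_le_add (hZ _ _) (hZ _ _)).trans ?_)
  rw [← mul_add]
  refine mul_le_mul_of_nonneg_left ?_ hK
  exact mul_add_mul_le_of_sq (norm_nonneg _) (norm_nonneg _)
    (norm_sq_weightOp_schemeM0_add_schemeM1_le b l n hΔt v)
    (norm_sq_weightOp_schemeM0_add_schemeM1_le b l n hΔt u)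

include hΔt in
theorem norm_schemeDual_apply_le (X : H →L[ℂ] H) : ‖schemeDual b l n Δt X‖ ≤ ‖X‖ := by
  refine FormBound.norm_le (norm_nonneg _) fun v u => ?_
  rw [inner_schemeDual]
  refine (norm_add_le _ _).trans ((add_le_add (formBound_one X _ _) (formBound_one X _ _)).trans ?_)
  rw [← mul_add]
  refine mul_le_mul_of_nonneg_left ?_ (norm_nonneg _)
  exact mul_add_mul_le_of_sq (norm_nonneg _) (norm_nonneg _)
    (norm_sq_schemeM0_add_schemeM1 b l n hΔt v).le (norm_sq_schemeM0_add_schemeM1 b l n hΔt u).le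

include hΔt in
theorem norm_schemeDual_pow_apply_le (N : ℕ) (X : H →L[ℂ] H) :
    ‖(schemeDual b l n Δt ^ N) X‖ ≤ ‖X‖ := by
  induction N with
  | zero => exact le_rfl
  | succ N ih =>
    rw [pow_succ']
    exact (norm_schemeDual_apply_le b l n hΔt _).trans ih

theorem FormBound.add {Y : H →L[ℂ] H} {K K' : ℝ} {Z Z' : H →L[ℂ] H} (h : FormBound Y K Z)
    (h' : FormBound Y K' Z') : FormBound Y (K + K') (Z + Z') := fun v u => by
  rw [add_apply, inner_add_right, add_mul]
  exact (norm_add_le _ _).trans (add_le_add (h v u) (h' v u))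

theorem FormBound.sub {Y : H →L[ℂ] H} {K K' : ℝ} {Z Z' : H →L[ℂ] H} (h : FormBound Y K Z)
    (h' : FormBound Y K' Z') : FormBound Y (K + K') (Z - Z') := fun v u => by
  rw [sub_apply, inner_sub_right, add_mul]
  exact (norm_sub_le _ _).trans (add_le_add (h v u) (h' v u))

include hΔt in
/-- Global error of the scheme: the local errors are propagated by the scheme itself, which is
stable in the weighted form norm. The constant `9` adds the local constants `4` of the dynamics and
`5` of the scheme. -/
theorem formBound_truncEvol_sub_schemeDual_pow {X : H →L[ℂ] H} {B : ℝ} (N : ℕ)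
    (hB : ∀ s ∈ Set.Icc 0 (N * Δt), ‖truncEvol b l n s X‖ ≤ B) :
    FormBound (weightOp b l n) (9 * B * (N * Δt) * Δt)
      (truncEvol b l n (N * Δt) X - (schemeDual b l n Δt ^ N) X) := by
  induction N with
  | zero =>
    intro v u
    rw [Nat.cast_zero, zero_mul, truncEvol_zero, pow_zero, sub_self]
    simp
  | succ N ih =>
    have hB' : ∀ s ∈ Set.Icc 0 (N * Δt + Δt), ‖truncEvol b l n s X‖ ≤ B := by
      intro s hs
      refine hB s ⟨hs.1, hs.2.trans (le_of_eq ?_)⟩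
      push_cast
      ring
    have hNΔ : 0 ≤ N * Δt := by positivity
    have hB0 : 0 ≤ B := (norm_nonneg _).trans (hB' 0 ⟨le_rfl, by positivity⟩)
    have h1 := FormBound.schemeDual hΔt (by positivity)
      (ih fun s hs => hB' s ⟨hs.1, hs.2.trans (by linarith)⟩)
    set Y := truncEvol b l n (N * Δt) X with hY
    have hYB (s : ℝ) : truncEvol b l n s Y = truncEvol b l n (N * Δt + s) X := by
      rw [add_comm, truncEvol_add]
      rfl
    have h2 := formBound_truncEvol_sub b l n hΔt (X := Y) (B := B) fun s hs => by
      rw [hYB]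
      exact hB' _ ⟨by linarith [hs.1], by linarith [hs.2]⟩
    have h3 := formBound_schemeDual_sub b l n hΔt Y
    have hYn : ‖Y‖ ≤ B := hB' _ ⟨hNΔ, by linarith⟩
    have h4 := (h2.sub h3).add h1
    have e : truncEvol b l n ((N + 1 : ℕ) * Δt) X - (schemeDual b l n Δt ^ (N + 1)) X
        = truncEvol b l n Δt Y - Y - (Δt : ℂ) • truncGen b l n Y
          - (schemeDual b l n Δt Y - Y - (Δt : ℂ) • truncGen b l n Y)
          + schemeDual b l n Δt (Y - (schemeDual b l n Δt ^ N) X) := by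
      rw [hYB, Nat.cast_succ, add_mul, one_mul, pow_succ', map_sub]
      change _ - schemeDual b l n Δt ((schemeDual b l n Δt ^ N) X) = _
      abel
    rw [e]
    intro v u
    refine (h4 v u).trans ?_
    gcongr
    push_cast
    have : 5 * ‖Y‖ * Δt ^ 2 ≤ 5 * B * Δt ^ 2 := by gcongr
    linarith

/-- The scheme converges to the truncated dynamics, which therefore inherits contractivity and
complete positivity. -/
theorem tendsto_inner_schemeDual_pow {t : ℝ} (ht : 0 ≤ t) (X : H →L[ℂ] H) (v u : H) :
    Tendsto (fun N : ℕ => inner ℂ v ((schemeDual b l n (t / (N + 1 : ℕ)) ^ (N + 1)) X u)) atTop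
      (𝓝 (inner ℂ v (truncEvol b l n t X u))) := by
  obtain ⟨B, hB⟩ := isCompact_Icc.exists_bound_of_continuousOn (s := Set.Icc 0 t)
    (continuous_truncEvol_apply b l n X).continuousOn
  set w := ‖weightOp b l n v‖ * ‖weightOp b l n u‖
  have h0 : Tendsto (fun N : ℕ => 9 * B * t * (t * (1 / ((N : ℝ) + 1))) * w) atTop (𝓝 0) := by
    have := ((tendsto_one_div_add_atTop_nhds_zero_nat (𝕜 := ℝ)).const_mul t).const_mul (9 * B * t)
    simpa using this.mul_const w
  refine tendsto_iff_norm_sub_tendsto_zero.2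
    (squeeze_zero (fun _ => norm_nonneg _) (fun N => ?_) h0)
  have hN : ((N + 1 : ℕ) : ℝ) ≠ 0 := by positivity
  have e : ((N + 1 : ℕ) : ℝ) * (t / (N + 1 : ℕ)) = t := mul_div_cancel₀ t hN
  have h1 := formBound_truncEvol_sub_schemeDual_pow b l n (X := X) (B := B)
    (Δt := t / (N + 1 : ℕ)) (by positivity) (N + 1) (by rw [e]; exact hB) v u
  rw [e, sub_apply, inner_sub_right] at h1
  rw [norm_sub_rev]
  refine h1.trans (le_of_eq ?_)
  push_cast
  ring

theorem norm_truncEvol_apply_le {t : ℝ} (ht : 0 ≤ t) (X : H →L[ℂ] H) :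
    ‖truncEvol b l n t X‖ ≤ ‖X‖ := by
  refine FormBound.norm_le (norm_nonneg _) fun v u => ?_
  refine le_of_tendsto (tendsto_inner_schemeDual_pow b l n ht X v u).norm
    (Eventually.of_forall fun N => ?_)
  refine (formBound_one _ v u).trans ?_
  gcongr
  exact norm_schemeDual_pow_apply_le b l n (by positivity) _ _

/-- Complete positivity, as positivity of the quadratic forms `∑ ⟨w_i, Φ(X_i† X_j) w_j⟩`. -/
def IsCPForm (Φ : (H →L[ℂ] H) → (H →L[ℂ] H)) : Prop :=
  ∀ (m : ℕ) (X : Fin m → (H →L[ℂ] H)) (w : Fin m → H),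
    0 ≤ ∑ j, ∑ i, inner ℂ (w i) (Φ (star (X i) * X j) (w j))

include hΔt in
theorem isCPForm_schemeDual_pow (N : ℕ) : IsCPForm (schemeDual b l n Δt ^ N) := by
  induction N with
  | zero =>
    intro m X w
    have e : ∑ j, ∑ i, inner ℂ (w i) ((schemeDual b l n Δt ^ 0) (star (X i) * X j) (w j))
        = inner ℂ (∑ i, X i (w i)) (∑ j, X j (w j)) := by
      rw [inner_sum]
      refine Finset.sum_congr rfl fun j _ => ?_
      rw [sum_inner]
      refine Finset.sum_congr rfl fun i _ => ?_
      rw [pow_zero]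
      exact inner_star_mul _ _ _ _
    rw [e, inner_self_eq_norm_sq_to_K]
    rw [← RCLike.ofReal_pow]
    exact Complex.zero_le_real.2 (sq_nonneg _)
  | succ N ih =>
    intro m X w
    have h := add_nonneg (ih m X fun i => schemeM0 b l n Δt (w i))
      (ih m X fun i => schemeM1 b l n Δt (w i))
    rw [← Finset.sum_add_distrib] at h
    refine h.trans_eq (Finset.sum_congr rfl fun j _ => ?_)
    rw [← Finset.sum_add_distrib]
    refine Finset.sum_congr rfl fun i _ => ?_
    rw [pow_succ', mul_apply_eq_comp, inner_schemeDual]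

theorem isCPForm_truncEvol {t : ℝ} (ht : 0 ≤ t) : IsCPForm (truncEvol b l n t) :=
  fun m X w => ge_of_tendsto (tendsto_finsetSum _ fun j _ => tendsto_finsetSum _ fun i _ =>
    tendsto_inner_schemeDual_pow b l n ht (star (X i) * X j) (w i) (w j))
    (Eventually.of_forall fun N => isCPForm_schemeDual_pow b l n (by positivity) _ m X w)

theorem truncGen_one : truncGen b l n 1 = 0 := by
  rw [truncGen_apply, mul_one, mul_one, one_mul, ← two_smul ℂ, smul_smul]
  norm_num
  exact sub_self _

/-! ### Consistency of the truncations -/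

/-- The corner `P_n X P_n` of an operator. -/
def corner : (H →L[ℂ] H) →L[ℂ] (H →L[ℂ] H) :=
  ContinuousLinearMap.mulLeftRight ℂ (H →L[ℂ] H) (fockProj b n) (fockProj b n)

theorem corner_apply (X : H →L[ℂ] H) : corner b n X = fockProj b n * X * fockProj b n := rfl

theorem inner_corner (X : H →L[ℂ] H) (v u : H) :
    inner ℂ v (corner b n X u) = inner ℂ (fockProj b n v) (X (fockProj b n u)) := by
  rw [inner_fockProj_left]
  rfl

theorem norm_corner_apply_le (X : H →L[ℂ] H) : ‖corner b n X‖ ≤ ‖X‖ := by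
  refine FormBound.norm_le (norm_nonneg _) fun v u => ?_
  rw [inner_corner]
  refine (formBound_one X _ _).trans ?_
  gcongr
  exacts [norm_fockProj_apply_le b n v, norm_fockProj_apply_le b n u]

theorem corner_corner {m n : ℕ} (h : m ≤ n) (X : H →L[ℂ] H) :
    corner b m (corner b n X) = corner b m X := by
  have h1 := fockProj_mul_fockProj b h
  have h2 := congrArg star h1
  rw [star_mul, star_fockProj, star_fockProj] at h2
  rw [corner_apply, corner_apply, corner_apply, ← mul_assoc, ← mul_assoc, h1, mul_assoc, h2]

/-- As the jumps leave each `H_m` invariant, the corners of the Heisenberg equation are closed. -/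
theorem semiconjBy_corner_truncGen {m n : ℕ} (h : m ≤ n) :
    SemiconjBy (corner b m) (truncGen b l n) (truncGen b l m) := by
  have hL := isShift_truncLossOp b l n
  have hA := isShift_truncNumOp b l n
  have hP := isShift_fockProj (b := b) m
  have hLm := isShift_truncLossOp b l m
  have hAm := isShift_truncNumOp b l m
  have e1 : truncLossOp b l n * fockProj b m = truncLossOp b l m :=
    (hL.mul_diag hP).eq (hLm.congr fun k => by
      rw [truncCoeff, truncCoeff]
      split_ifs <;> first | omega | simp)
  have e2 : fockProj b m * truncLossOp b l m = truncLossOp b l m := by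
    rw [← e1, ← mul_assoc, hL.fockProj_mul_mul]
  have e3 : truncNumOp b l n * fockProj b m = truncNumOp b l m :=
    (hA.mul_diag hP).eq (hAm.congr fun k => by
      rw [truncCoeff, truncCoeff]
      split_ifs <;> first | omega | simp)
  have e4 : fockProj b m * truncNumOp b l n = truncNumOp b l m :=
    (hP.mul_diag hA).eq (hAm.congr fun k => by
      rw [truncCoeff, truncCoeff]
      split_ifs <;> first | omega | simp)
  have e5 : truncNumOp b l m * fockProj b m = truncNumOp b l m :=
    (hAm.mul_diag hP).eq (hAm.congr fun k => by
      rw [truncCoeff]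
      split_ifs <;> simp)
  have e6 : fockProj b m * truncNumOp b l m = truncNumOp b l m :=
    (hP.mul_diag hAm).eq (hAm.congr fun k => by
      rw [truncCoeff]
      split_ifs <;> simp)
  have e1' := congrArg star e1
  rw [star_mul, star_fockProj] at e1'
  have e2' := congrArg star e2
  rw [star_mul, star_fockProj] at e2'
  refine ContinuousLinearMap.ext fun X => ?_
  change corner b m (truncGen b l n X) = truncGen b l m (corner b m X)
  rw [truncGen_apply, truncGen_apply, corner_apply, corner_apply]
  set P := fockProj b m
  have f1 : P * (star (truncLossOp b l n) * X * truncLossOp b l n) * P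
      = star (truncLossOp b l m) * (P * X * P) * truncLossOp b l m := by
    calc _ = (P * star (truncLossOp b l n)) * X * (truncLossOp b l n * P) := by
          simp only [mul_assoc]
      _ = (star (truncLossOp b l m) * P) * X * (P * truncLossOp b l m) := by rw [e1, e1', e2, e2']
      _ = _ := by simp only [mul_assoc]
  have f2 : P * (truncNumOp b l n * X) * P = truncNumOp b l m * (P * X * P) := by
    rw [← mul_assoc, e4, ← mul_assoc, ← mul_assoc, e5]
  have f3 : P * (X * truncNumOp b l n) * P = P * X * P * truncNumOp b l m := by
    rw [mul_assoc, mul_assoc, e3, mul_assoc, mul_assoc, e6]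
  rw [mul_sub, sub_mul, f1, mul_smul_comm, smul_mul_assoc, mul_add, add_mul, f2, f3]

theorem corner_truncEvol {m n : ℕ} (h : m ≤ n) (t : ℝ) (X : H →L[ℂ] H) :
    corner b m (truncEvol b l n t X) = truncEvol b l m t (corner b m X) :=
  congrArg (fun Φ : (H →L[ℂ] H) →L[ℂ] (H →L[ℂ] H) => Φ X)
    (semiconjBy_expFlow (semiconjBy_corner_truncGen b l h) t).eq

theorem truncEvol_one (t : ℝ) : truncEvol b l n t 1 = 1 := by
  have h1 : ∀ s, HasDerivAt (fun t => truncEvol b l n t 1) 0 s := fun s => by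
    refine (hasDerivAt_truncEvol b l n 1 s).congr_deriv ?_
    calc truncGen b l n (truncEvol b l n s 1) = truncEvol b l n s (truncGen b l n 1) :=
          congrArg (fun Φ : (H →L[ℂ] H) →L[ℂ] (H →L[ℂ] H) => Φ 1)
            (expFlow_mul_comm (truncGen b l n) s)
      _ = 0 := by rw [truncGen_one, map_zero]
  have h2 := is_const_of_deriv_eq_zero (fun s => (h1 s).differentiableAt) (fun s => (h1 s).deriv) t 0
  rw [h2, truncEvol_zero]
  rfl

end Dynamics

/-! ### Operators from their corners and weak operator convergence -/

section Corners

variable (b : HilbertBasis ℕ ℂ H)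

theorem corner_ext {X Y : H →L[ℂ] H} (h : ∀ n, corner b n X = corner b n Y) : X = Y := by
  refine ext_matrix b fun i j => ?_
  have h1 := congrArg (fun Z : H →L[ℂ] H => inner ℂ (b i) (Z (b j))) (h (max i j))
  simpa only [inner_corner, fockProj_basis, le_max_left, le_max_right, if_true] using h1

theorem inner_basis_eq_corner {n i j : ℕ} (hi : i ≤ n) (hj : j ≤ n) (X : H →L[ℂ] H) :
    inner ℂ (b i) (X (b j)) = inner ℂ (b i) (corner b n X (b j)) := by
  rw [inner_corner, fockProj_basis, fockProj_basis, if_pos hi, if_pos hj]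

/-- A bounded sequence of vectors which are truncations of each other is the sequence of
truncations of one vector. -/
theorem exists_of_truncations {f : ℕ → H} {C : ℝ} {m : ℕ} (hC : ∀ n, ‖f n‖ ≤ C)
    (hf : ∀ n k, n ≤ k → fockProj b (n + m) (f k) = f n) :
    ∃ w, ∀ n, fockProj b (n + m) w = f n := by
  have hcoord {i n : ℕ} (hi : i ≤ n + m) : inner ℂ (b i) (f i) = inner ℂ (b i) (f n) := by
    rcases le_total n i with h | h
    · rw [← hf n i h, inner_basis_fockProj, if_pos hi]
    · rw [← hf i n h, inner_basis_fockProj, if_pos (by omega)]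
  have hmem : Memℓp (fun i => inner ℂ (b i) (f i)) 2 := by
    refine memℓp_gen' (C := C ^ 2) fun s => ?_
    obtain ⟨N, hN⟩ := s.exists_nat_subset_range
    calc ∑ i ∈ s, ‖inner ℂ (b i) (f i)‖ ^ (2 : ℝ≥0∞).toReal
        = ∑ i ∈ s, ‖inner ℂ (b i) (f N)‖ ^ 2 := by
          refine Finset.sum_congr rfl fun i hi => ?_
          have := Finset.mem_range.1 (hN hi)
          rw [hcoord (n := N) (by omega)]
          simp
      _ ≤ ‖f N‖ ^ 2 := sum_le_hasSum s (fun _ _ => by positivity) (hasSum_norm_sq b (f N))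
      _ ≤ C ^ 2 := pow_le_pow_left₀ (norm_nonneg _) (hC N) 2
  refine ⟨b.repr.symm ⟨_, hmem⟩, fun n => eq_of_inner_basis b fun i => ?_⟩
  rw [inner_basis_fockProj, ← b.repr_apply_apply, LinearIsometryEquiv.apply_symm_apply]
  change (if i ≤ n + m then inner ℂ (b i) (f i) else 0) = _
  split_ifs with hi
  · exact hcoord hi
  · rw [← hf n n le_rfl, inner_basis_fockProj, if_neg hi]

/-- A bounded sequence of operators which are corners of each other is the sequence of corners of
one operator. -/
theorem exists_of_corners {Z : ℕ → (H →L[ℂ] H)} {C : ℝ} (hC : ∀ n, ‖Z n‖ ≤ C)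
    (hZ : ∀ m n, m ≤ n → corner b m (Z n) = Z m) :
    ∃ X : H →L[ℂ] H, ‖X‖ ≤ C ∧ ∀ n, corner b n X = Z n := by
  have hC0 : 0 ≤ C := (norm_nonneg _).trans (hC 0)
  have hfin (m : ℕ) (y : H) : CauchySeq fun n => Z n (fockProj b m y) := by
    obtain ⟨w, hw⟩ := exists_of_truncations b (f := fun n => Z (n + m) (fockProj b m y))
      (C := C * ‖fockProj b m y‖) (m := m)
      (fun n => (Z (n + m)).le_of_opNorm_le (hC _) _) (fun n k hnk => by
        have h1 := congrArg (fun A : H →L[ℂ] H => A (fockProj b m y))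
          (hZ (n + m) (k + m) (by omega))
        have h2 := congrArg (fun A : H →L[ℂ] H => star A y)
          (fockProj_mul_fockProj b (show m ≤ n + m by omega))
        simp only [star_mul, star_fockProj] at h2
        simp only [corner_apply, mul_apply_eq_comp] at h1 h2
        rwa [h2] at h1)
    have h3 : Tendsto (fun n => Z (n + m) (fockProj b m y)) atTop (𝓝 w) :=
      ((tendsto_fockProj b w).comp (tendsto_add_atTop_nat m)).congr hw
    exact ((tendsto_add_atTop_iff_nat m).1 h3).cauchySeq
  have hcauchy (y : H) : CauchySeq fun n => Z n y := by
    refine Metric.cauchySeq_iff'.2 fun ε hε => ?_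
    obtain ⟨m, hm⟩ := ((Metric.tendsto_atTop.1 (tendsto_fockProj b y)) (ε / (3 * (C + 1)))
      (by positivity))
    have hm := hm m le_rfl
    obtain ⟨N, hN⟩ := Metric.cauchySeq_iff'.1 (hfin m y) (ε / 3) (by positivity)
    refine ⟨N, fun n hn => ?_⟩
    have h1 (k : ℕ) : dist (Z k y) (Z k (fockProj b m y)) < ε / 3 := by
      rw [dist_eq_norm, ← map_sub]
      refine ((Z k).le_of_opNorm_le (hC k) _).trans_lt ?_
      rw [dist_comm, dist_eq_norm, lt_div_iff₀ (by positivity)] at hm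
      have := norm_nonneg (y - fockProj b m y)
      nlinarith
    calc dist (Z n y) (Z N y) ≤ dist (Z n y) (Z n (fockProj b m y))
          + dist (Z n (fockProj b m y)) (Z N (fockProj b m y))
          + dist (Z N (fockProj b m y)) (Z N y) := dist_triangle4 _ _ _ _
      _ < ε / 3 + ε / 3 + ε / 3 := by
        have := hN n hn
        have h2 := h1 N
        rw [dist_comm] at h2
        linarith [h1 n]
      _ = ε := by ring
  choose f hf using fun y => cauchySeq_tendsto_of_complete (hcauchy y)
  let X := ContinuousLinearMap.ofTendstoOfBoundedRange (l := atTop) f Z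
    (tendsto_pi_nhds.2 hf) (isBounded_iff_forall_norm_le.2 ⟨C, by rintro _ ⟨n, rfl⟩; exact hC n⟩)
  refine ⟨X, ?_, fun m => ?_⟩
  · refine ContinuousLinearMap.opNorm_le_bound _ hC0 fun y => ?_
    exact le_of_tendsto (hf y).norm (Eventually.of_forall fun n => (Z n).le_of_opNorm_le (hC n) y)
  · ext y
    have h1 : Tendsto (fun n => corner b m (Z n) y) atTop (𝓝 (corner b m X y)) :=
      ((fockProj b m).continuous.tendsto _).comp (hf (fockProj b m y))
    exact tendsto_nhds_unique h1 (tendsto_const_nhds.congr'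
      ((eventually_ge_atTop m).mono fun n hn => congrArg (fun A : H →L[ℂ] H => A y) (hZ m n hn).symm))

theorem tendsto_of_tendsto_basis {ι : Type*} {F : Filter ι} {g : ι → (H →L[ℂ] ℂ)} {g' : H →L[ℂ] ℂ}
    {C : ℝ} (hC : ∀ i, ‖g i‖ ≤ C) (h : ∀ k, Tendsto (fun i => g i (b k)) F (𝓝 (g' (b k))))
    (x : H) : Tendsto (fun i => g i x) F (𝓝 (g' x)) := by
  have heq : Equicontinuous fun i => (g i : H → ℂ) :=
    (LipschitzWith.uniformEquicontinuous _ C.toNNReal fun i =>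
      (g i).lipschitz.weaken (by
        rw [← NNReal.coe_le_coe, coe_nnnorm]
        exact (hC i).trans (Real.le_coe_toNNReal C))).equicontinuous
  have hcl := heq.isClosed_setOfPred_tendsto (l := F) g'.continuous
  have hsub : (Submodule.span ℂ (Set.range b) : Set H)
      ⊆ {x | Tendsto (fun i => g i x) F (𝓝 (g' x))} := by
    intro y hy
    induction hy using Submodule.span_induction with
    | mem y hy =>
      obtain ⟨k, rfl⟩ := hy
      exact h k
    | zero => simpa using tendsto_const_nhds
    | add y z _ _ hy hz => simpa using Tendsto.add hy hz
    | smul c y _ hy => simpa using Tendsto.const_mul c hy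
  exact closure_minimal hsub hcl (dense_span_range b x)

/-- On bounded sets, weak operator convergence is convergence of the matrix elements. -/
theorem tendsto_inner_of_tendsto_matrix {ι : Type*} {F : Filter ι} {Z : ι → (H →L[ℂ] H)}
    {Z' : H →L[ℂ] H} {C : ℝ} (hC : ∀ i, ‖Z i‖ ≤ C)
    (h : ∀ j k, Tendsto (fun i => inner ℂ (b j) (Z i (b k))) F (𝓝 (inner ℂ (b j) (Z' (b k)))))
    (x y : H) : Tendsto (fun i => inner ℂ x (Z i y)) F (𝓝 (inner ℂ x (Z' y))) := by
  have h1 (j : ℕ) (y : H) :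
      Tendsto (fun i => inner ℂ (b j) (Z i y)) F (𝓝 (inner ℂ (b j) (Z' y))) := by
    refine tendsto_of_tendsto_basis b (g := fun i => innerSL ℂ (b j) ∘L Z i)
      (g' := innerSL ℂ (b j) ∘L Z') (C := C) (fun i => ?_) (h j) y
    refine (ContinuousLinearMap.opNorm_comp_le _ _).trans ?_
    rw [innerSL_apply_norm, norm_basis, one_mul]
    exact hC i
  have h2 : Tendsto (fun i => inner ℂ (Z i y) x) F (𝓝 (inner ℂ (Z' y) x)) := by
    refine tendsto_of_tendsto_basis b (g := fun i => innerSL ℂ (Z i y))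
      (g' := innerSL ℂ (Z' y)) (C := C * ‖y‖) (fun i => ?_) (fun k => ?_) x
    · rw [innerSL_apply_norm]
      exact (Z i).le_of_opNorm_le (hC i) y
    · have := (Complex.continuous_conj.tendsto _).comp (h1 k y)
      simpa only [Function.comp_def, inner_conj_symm, innerSL_apply_apply] using this
  have := (Complex.continuous_conj.tendsto _).comp h2
  simpa only [Function.comp_def, inner_conj_symm] using this

/-- The matrix unit `|i⟩⟨j|`. -/
def matrixUnit (i j : ℕ) : H →L[ℂ] H := InnerProductSpace.rankOne ℂ (b i) (b j)

theorem matrixUnit_apply (i j : ℕ) (x : H) : matrixUnit b i j x = inner ℂ (b j) x • b i := rfl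

theorem corner_eq_sum (n : ℕ) (X : H →L[ℂ] H) :
    corner b n X = ∑ i ∈ Finset.range (n + 1), ∑ j ∈ Finset.range (n + 1),
      inner ℂ (b i) (X (b j)) • matrixUnit b i j := by
  refine ext_matrix b fun p q => ?_
  simp only [inner_corner, fockProj_basis, sum_apply, smul_apply,
    matrixUnit_apply, inner_sum, inner_smul_right, inner_basis]
  by_cases hp : p ≤ n <;> by_cases hq : q ≤ n <;> simp [hp, hq]

theorem bounded_of_tendsto_inner {X : ℕ → (H →L[ℂ] H)} {X' : H →L[ℂ] H}
    (h : ∀ u v : H, Tendsto (fun k => inner ℂ u (X k v)) atTop (𝓝 (inner ℂ u (X' v)))) :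
    ∃ C, ∀ k, ‖X k‖ ≤ C := by
  refine banach_steinhaus fun v => ?_
  obtain ⟨C, hC⟩ := banach_steinhaus (g := fun k => innerSL ℂ (X k v)) fun u => by
    obtain ⟨C, hC⟩ := isBounded_iff_forall_norm_le.1 (Metric.isBounded_range_of_tendsto _ (h u v))
    refine ⟨C, fun k => ?_⟩
    rw [innerSL_apply_apply, norm_inner_symm]
    exact hC _ ⟨k, rfl⟩
  refine ⟨C, fun k => ?_⟩
  have := hC k
  rwa [innerSL_apply_norm] at this

end Corners

/-! ### The Heisenberg semigroup of the photon loss equation -/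

section Evol

variable (b : HilbertBasis ℕ ℂ H) (l : ℕ)

/-- The corners evolved by the truncated equations are corners of each other and bounded by `‖X‖`,
hence come from one operator. -/
theorem exists_lossEvol (t : ℝ≥0) (X : H →L[ℂ] H) :
    ∃ Y : H →L[ℂ] H, ‖Y‖ ≤ ‖X‖ ∧ ∀ n, corner b n Y = truncEvol b l n t (corner b n X) := by
  refine exists_of_corners b (fun n => ?_) fun m n h => ?_
  · exact (norm_truncEvol_apply_le b l n t.2 _).trans (norm_corner_apply_le b n X)
  · rw [corner_truncEvol b l h, corner_corner b h]

/-- The Heisenberg semigroup of `dρ/dt = D[a^l](ρ)`: the operator `𝒯_t(X)` is the one whose corner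
of size `n` evolves by the equation truncated at level `n`. -/
def lossEvol (t : ℝ≥0) : (H →L[ℂ] H) →ₗ[ℂ] (H →L[ℂ] H) where
  toFun X := (exists_lossEvol b l t X).choose
  map_add' X Y := corner_ext b fun n => by
    refine ((exists_lossEvol b l t (X + Y)).choose_spec.2 n).trans ?_
    rw [map_add, map_add, map_add, (exists_lossEvol b l t X).choose_spec.2 n,
      (exists_lossEvol b l t Y).choose_spec.2 n]
  map_smul' c X := corner_ext b fun n => by
    refine ((exists_lossEvol b l t (c • X)).choose_spec.2 n).trans ?_
    rw [RingHom.id_apply, map_smul, map_smul, map_smul, (exists_lossEvol b l t X).choose_spec.2 n]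

theorem corner_lossEvol (t : ℝ≥0) (X : H →L[ℂ] H) (n : ℕ) :
    corner b n (lossEvol b l t X) = truncEvol b l n t (corner b n X) :=
  (exists_lossEvol b l t X).choose_spec.2 n

theorem corner_lossEvol' (t : ℝ≥0) (X : H →L[ℂ] H) (n : ℕ) :
    corner b n (lossEvol b l t X) = corner b n (truncEvol b l n t X) := by
  rw [corner_lossEvol, corner_truncEvol b l le_rfl]

theorem norm_lossEvol_apply_le (t : ℝ≥0) (X : H →L[ℂ] H) : ‖lossEvol b l t X‖ ≤ ‖X‖ :=
  (exists_lossEvol b l t X).choose_spec.1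

theorem lossEvol_zero (X : H →L[ℂ] H) : lossEvol b l 0 X = X := corner_ext b fun n => by
  rw [corner_lossEvol, NNReal.coe_zero, truncEvol_zero]
  rfl

theorem lossEvol_add (t s : ℝ≥0) (X : H →L[ℂ] H) :
    lossEvol b l (t + s) X = lossEvol b l t (lossEvol b l s X) := corner_ext b fun n => by
  rw [corner_lossEvol, corner_lossEvol, corner_lossEvol, NNReal.coe_add, truncEvol_add]
  rfl

theorem lossEvol_one (t : ℝ≥0) : lossEvol b l t 1 = 1 := corner_ext b fun n => by
  rw [corner_lossEvol', truncEvol_one]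

theorem isCPForm_lossEvol (t : ℝ≥0) : IsCPForm (lossEvol b l t : (H →L[ℂ] H) → (H →L[ℂ] H)) := by
  intro m X w
  have h1 (i j : Fin m) : Tendsto (fun n => inner ℂ (fockProj b n (w i))
      (lossEvol b l t (star (X i) * X j) (fockProj b n (w j)))) atTop
      (𝓝 (inner ℂ (w i) (lossEvol b l t (star (X i) * X j) (w j)))) :=
    (tendsto_fockProj b (w i)).inner
      (((lossEvol b l t (star (X i) * X j)).continuous.tendsto _).comp (tendsto_fockProj b (w j)))
  refine ge_of_tendsto (tendsto_finsetSum _ fun j _ => tendsto_finsetSum _ fun i _ => h1 i j)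
    (Eventually.of_forall fun n => ?_)
  simp_rw [← inner_corner, corner_lossEvol', inner_corner]
  exact isCPForm_truncEvol b l n t.2 m X fun i => fockProj b n (w i)

theorem continuous_inner_lossEvol (X : H →L[ℂ] H) (x y : H) :
    Continuous fun t : ℝ≥0 => inner ℂ x (lossEvol b l t X y) := by
  refine continuous_iff_continuousAt.2 fun t => ?_
  refine tendsto_inner_of_tendsto_matrix b (C := ‖X‖)
    (fun s => norm_lossEvol_apply_le b l s X) (fun j k => ?_) x y
  have e (s : ℝ≥0) : inner ℂ (b j) (lossEvol b l s X (b k))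
      = inner ℂ (b j) (truncEvol b l (max j k) s (corner b (max j k) X) (b k)) := by
    rw [inner_basis_eq_corner b (le_max_left j k) (le_max_right j k), corner_lossEvol]
  rw [e t, funext e]
  have h1 : Continuous fun s : ℝ≥0 =>
      inner ℂ (b j) (truncEvol b l (max j k) s (corner b (max j k) X) (b k)) :=
    continuous_const.inner (((continuous_truncEvol_apply b l (max j k)
      (corner b (max j k) X)).comp NNReal.continuous_coe).clm_apply continuous_const)
  exact h1.tendsto t

theorem tendsto_inner_lossEvol {X : ℕ → (H →L[ℂ] H)} {X' : H →L[ℂ] H}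
    (h : ∀ u v : H, Tendsto (fun k => inner ℂ u (X k v)) atTop (𝓝 (inner ℂ u (X' v))))
    (t : ℝ≥0) (u v : H) :
    Tendsto (fun k => inner ℂ u (lossEvol b l t (X k) v)) atTop
      (𝓝 (inner ℂ u (lossEvol b l t X' v))) := by
  obtain ⟨C, hC⟩ := bounded_of_tendsto_inner h
  refine tendsto_inner_of_tendsto_matrix b (C := C)
    (fun k => (norm_lossEvol_apply_le b l t _).trans (hC k)) (fun i j => ?_) u v
  have e (Y : H →L[ℂ] H) : inner ℂ (b i) (lossEvol b l t Y (b j))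
      = inner ℂ (b i) (truncEvol b l (max i j) t (corner b (max i j) Y) (b j)) := by
    rw [inner_basis_eq_corner b (le_max_left i j) (le_max_right i j), corner_lossEvol]
  rw [e X', funext fun k => e (X k)]
  have h1 : Tendsto (fun k => corner b (max i j) (X k)) atTop (𝓝 (corner b (max i j) X')) := by
    simp_rw [corner_eq_sum]
    exact tendsto_finsetSum _ fun p _ => tendsto_finsetSum _ fun q _ =>
      (h (b p) (b q)).smul tendsto_const_nhds
  have h2 : Continuous fun Z : H →L[ℂ] H =>
      inner ℂ (b i) (truncEvol b l (max i j) t Z (b j)) :=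
    continuous_const.inner ((truncEvol b l (max i j) t).continuous.clm_apply continuous_const)
  exact (h2.tendsto _).comp h1

end Evol

/-! ### Polar decomposition -/

/-- Douglas' factorization lemma. -/
theorem exists_contraction_mul_eq {A B : H →L[ℂ] H} (h : ∀ x, ‖A x‖ ≤ ‖B x‖) :
    ∃ V : H →L[ℂ] H, ‖V‖ ≤ 1 ∧ V * B = A := by
  let K := (LinearMap.range (B : H →ₗ[ℂ] H)).topologicalClosure
  have hK (x : H) : B x ∈ K := Submodule.le_topologicalClosure _ ⟨x, rfl⟩
  let e : H →ₗ[ℂ] K := (B : H →ₗ[ℂ] H).codRestrict K hK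
  have he : DenseRange e := by
    intro y
    rw [closure_subtype]
    have h1 : (y : H) ∈ closure (Set.range B) := y.2
    refine closure_mono ?_ h1
    rintro _ ⟨x, rfl⟩
    exact ⟨e x, ⟨x, rfl⟩, rfl⟩
  have hn (x : H) : ‖(A : H →ₗ[ℂ] H) x‖ ≤ 1 * ‖e x‖ := by
    rw [one_mul]
    exact h x
  have : CompleteSpace K := (Submodule.isClosed_topologicalClosure _).completeSpace_coe
  refine ⟨(A : H →ₗ[ℂ] H).extendOfNorm e ∘L K.orthogonalProjectionOnto, ?_, ?_⟩
  · refine ContinuousLinearMap.opNorm_le_bound _ zero_le_one fun x => ?_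
    refine (LinearMap.norm_extendOfNorm_apply_le he 1 hn _).trans ?_
    rw [one_mul, one_mul]
    exact K.norm_orthogonalProjectionOnto_apply_le x
  · ext x
    change (A : H →ₗ[ℂ] H).extendOfNorm e (K.orthogonalProjectionOnto (B x)) = A x
    have h1 : K.orthogonalProjectionOnto (B x) = e x :=
      Submodule.orthogonalProjectionOnto_mem_subspace_eq_self (e x)
    rw [h1, LinearMap.extendOfNorm_eq he ⟨1, hn⟩]
    rfl

theorem norm_abs_apply (A : H →L[ℂ] H) (x : H) : ‖CFC.abs A x‖ = ‖A x‖ := by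
  have h1 : star (CFC.abs A) * CFC.abs A = star A * A := by
    rw [(CFC.abs_nonneg A).isSelfAdjoint.star_eq, CFC.abs_mul_abs]
  have h2 := congrArg (fun Z : H →L[ℂ] H => inner ℂ x (Z x)) h1
  simp only [inner_star_mul, inner_self_eq_norm_sq_to_K] at h2
  have h3 : ‖CFC.abs A x‖ ^ 2 = ‖A x‖ ^ 2 := by exact_mod_cast h2
  exact (sq_eq_sq₀ (norm_nonneg _) (norm_nonneg _)).1 h3

theorem exists_contraction_mul_abs (A : H →L[ℂ] H) :
    ∃ V : H →L[ℂ] H, ‖V‖ ≤ 1 ∧ V * CFC.abs A = A :=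
  exists_contraction_mul_eq fun x => (norm_abs_apply A x).ge

theorem exists_contraction_mul_eq_abs (A : H →L[ℂ] H) :
    ∃ V : H →L[ℂ] H, ‖V‖ ≤ 1 ∧ V * A = CFC.abs A :=
  exists_contraction_mul_eq fun x => (norm_abs_apply A x).le

/-! ### Hilbert–Schmidt operators -/

section HilbertSchmidt

variable (b : HilbertBasis ℕ ℂ H)

/-- `C` is a Hilbert–Schmidt operator. -/
def IsHilbertSchmidt (C : H →L[ℂ] H) : Prop := Summable fun k => ‖C (b k)‖ ^ 2

variable {b} {C D : H →L[ℂ] H}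

theorem isHilbertSchmidt_iff :
    IsHilbertSchmidt b C ↔ Summable fun p : ℕ × ℕ => ‖inner ℂ (b p.2) (C (b p.1))‖ ^ 2 := by
  rw [summable_prod_of_nonneg fun _ => by positivity]
  simp only [(hasSum_norm_sq b _).tsum_eq]
  exact ⟨fun h => ⟨fun k => (hasSum_norm_sq b (C (b k))).summable, h⟩, fun h => h.2⟩

theorem norm_inner_star (C : H →L[ℂ] H) (x y : H) : ‖inner ℂ x (star C y)‖ = ‖inner ℂ y (C x)‖ := by
  rw [ContinuousLinearMap.star_eq_adjoint, ContinuousLinearMap.adjoint_inner_right,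
    norm_inner_symm]

theorem IsHilbertSchmidt.star (h : IsHilbertSchmidt b C) : IsHilbertSchmidt b (star C) := by
  rw [isHilbertSchmidt_iff] at h ⊢
  refine ((Equiv.prodComm ℕ ℕ).summable_iff.2 h).congr fun p => ?_
  simp only [norm_inner_star]
  rfl

theorem IsHilbertSchmidt.mul_left (h : IsHilbertSchmidt b C) (V : H →L[ℂ] H) :
    IsHilbertSchmidt b (V * C) := by
  refine Summable.of_nonneg_of_le (fun _ => by positivity) (fun k => ?_) (Summable.mul_left (‖V‖ ^ 2) h)
  rw [← mul_pow]
  exact pow_le_pow_left₀ (norm_nonneg _) (V.le_opNorm _) 2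

theorem IsHilbertSchmidt.mul_right (h : IsHilbertSchmidt b C) (V : H →L[ℂ] H) :
    IsHilbertSchmidt b (C * V) := by
  have := (h.star.mul_left (Star.star V)).star
  rwa [star_mul, star_star, star_star] at this

theorem IsHilbertSchmidt.tsum_norm_sq_star (h : IsHilbertSchmidt b C) :
    ∑' k, ‖Star.star C (b k)‖ ^ 2 = ∑' k, ‖C (b k)‖ ^ 2 := by
  have h1 := isHilbertSchmidt_iff.1 h
  have h2 := h1.tsum_comm (f := fun k j => ‖inner ℂ (b j) (C (b k))‖ ^ 2)
  simp_rw [← norm_inner_star C, (hasSum_norm_sq b _).tsum_eq] at h2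
  simp_rw [norm_inner_star, (hasSum_norm_sq b _).tsum_eq] at h2
  exact h2

theorem IsHilbertSchmidt.summable_mul (hD : IsHilbertSchmidt b D) (hC : IsHilbertSchmidt b C) :
    Summable fun k => ‖D (b k)‖ * ‖C (b k)‖ :=
  Summable.of_nonneg_of_le (fun _ => by positivity)
    (fun k => by
      have h1 := two_mul_le_add_sq ‖D (b k)‖ ‖C (b k)‖
      have h2 : 0 ≤ ‖D (b k)‖ * ‖C (b k)‖ := by positivity
      linarith) (Summable.add hD hC)

theorem IsHilbertSchmidt.summable_inner (hD : IsHilbertSchmidt b D) (hC : IsHilbertSchmidt b C) :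
    Summable fun k => inner ℂ (b k) ((Star.star D * C) (b k)) :=
  Summable.of_norm_bounded (hD.summable_mul hC) fun k => by
    rw [inner_star_mul]
    exact norm_inner_le_norm _ _

theorem IsHilbertSchmidt.trace_comm (hD : IsHilbertSchmidt b D) (hC : IsHilbertSchmidt b C) :
    trace b (Star.star D * C) = trace b (C * Star.star D) := by
  have hs : Summable fun p : ℕ × ℕ => inner ℂ (D (b p.1)) (b p.2) * inner ℂ (b p.2) (C (b p.1)) := by
    refine Summable.of_norm_bounded
      (Summable.add (isHilbertSchmidt_iff.1 hD) (isHilbertSchmidt_iff.1 hC)) fun p => ?_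
    rw [norm_mul, norm_inner_symm]
    have h1 := two_mul_le_add_sq ‖inner ℂ (b p.2) (D (b p.1))‖ ‖inner ℂ (b p.2) (C (b p.1))‖
    have h2 : 0 ≤ ‖inner ℂ (b p.2) (D (b p.1))‖ * ‖inner ℂ (b p.2) (C (b p.1))‖ := by positivity
    linarith
  have h1 := hs.tsum_comm
    (f := fun k j => inner ℂ (D (b k)) (b j) * inner ℂ (b j) (C (b k)))
  simp_rw [b.tsum_inner_mul_inner] at h1
  rw [trace, trace]
  simp_rw [inner_star_mul]
  rw [← h1]
  refine tsum_congr fun j => ?_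
  have h2 (k : ℕ) : inner ℂ (D (b k)) (b j) * inner ℂ (b j) (C (b k))
      = inner ℂ (Star.star C (b j)) (b k) * inner ℂ (b k) (Star.star D (b j)) := by
    rw [ContinuousLinearMap.star_eq_adjoint, ContinuousLinearMap.star_eq_adjoint,
      ContinuousLinearMap.adjoint_inner_right, ContinuousLinearMap.adjoint_inner_left, mul_comm]
  simp_rw [h2, b.tsum_inner_mul_inner]
  rw [ContinuousLinearMap.star_eq_adjoint C, ContinuousLinearMap.adjoint_inner_left]
  rfl

end HilbertSchmidt

/-! ### Trace class operators -/

section TraceClass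

variable {b : HilbertBasis ℕ ℂ H} {ρ : H →L[ℂ] H}

theorem norm_sq_sqrt_apply {A : H →L[ℂ] H} (hA : 0 ≤ A) (x : H) :
    ‖CFC.sqrt A x‖ ^ 2 = (inner ℂ x (A x)).re := by
  have h1 : star (CFC.sqrt A) * CFC.sqrt A = A := by
    rw [(CFC.sqrt_nonneg A).isSelfAdjoint.star_eq, CFC.sqrt_mul_sqrt_self A]
  conv_rhs => rw [← h1]
  rw [inner_star_mul]
  exact (inner_self_eq_norm_sq (𝕜 := ℂ) _).symm

theorem IsTraceClass.isHilbertSchmidt_sqrt (h : IsTraceClass b ρ) :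
    IsHilbertSchmidt b (CFC.sqrt (CFC.abs ρ)) := by
  have h1 : ∑' k, ENNReal.ofReal (inner ℂ (b k) (CFC.abs ρ (b k))).re ≠ ∞ := h.ne
  have h2 := ENNReal.summable_toReal h1
  refine h2.congr fun k => ?_
  rw [← norm_sq_sqrt_apply (CFC.abs_nonneg ρ), ENNReal.toReal_ofReal (by positivity)]

/-- A trace class operator is a product of two Hilbert–Schmidt operators. -/
theorem IsTraceClass.exists_eq_star_mul (h : IsTraceClass b ρ) :
    ∃ D C : H →L[ℂ] H, IsHilbertSchmidt b D ∧ IsHilbertSchmidt b C ∧ ρ = star D * C := by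
  obtain ⟨V, -, hV⟩ := exists_contraction_mul_abs ρ
  have hC := h.isHilbertSchmidt_sqrt
  refine ⟨CFC.sqrt (CFC.abs ρ) * star V, CFC.sqrt (CFC.abs ρ), hC.mul_right _, hC, ?_⟩
  rw [star_mul, star_star, (CFC.sqrt_nonneg _).isSelfAdjoint.star_eq, mul_assoc,
    CFC.sqrt_mul_sqrt_self _ (CFC.abs_nonneg ρ), hV]

theorem IsTraceClass.summable (h : IsTraceClass b ρ) (X : H →L[ℂ] H) :
    Summable fun k => inner ℂ (b k) ((ρ * X) (b k)) := by
  obtain ⟨D, C, hD, hC, rfl⟩ := h.exists_eq_star_mul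
  rw [mul_assoc]
  exact hD.summable_inner (hC.mul_right X)

/-- Cyclicity of the trace, for operators on both sides of a trace class one. -/
theorem IsTraceClass.trace_mul_mul_comm (h : IsTraceClass b ρ) (M X : H →L[ℂ] H) :
    trace b (M * ρ * X) = trace b (ρ * (X * M)) := by
  obtain ⟨D, C, hD, hC, rfl⟩ := h.exists_eq_star_mul
  have e1 : M * (star D * C) * X = star (D * star M) * (C * X) := by
    rw [star_mul, star_star]
    simp only [mul_assoc]
  rw [e1, (hD.mul_right _).trace_comm (hC.mul_right X), mul_assoc (star D),
    hD.trace_comm (hC.mul_right (X * M)), star_mul, star_star]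
  simp only [mul_assoc]

theorem IsTraceClass.trace_comm (h : IsTraceClass b ρ) (M : H →L[ℂ] H) :
    trace b (M * ρ) = trace b (ρ * M) := by
  have := h.trace_mul_mul_comm M 1
  rwa [mul_one, one_mul] at this

/-- The linear functional `X ↦ tr (ρ X)` of a trace class operator `ρ`. -/
def IsTraceClass.pairing (h : IsTraceClass b ρ) : (H →L[ℂ] H) →ₗ[ℂ] ℂ where
  toFun X := trace b (ρ * X)
  map_add' X Y := by
    rw [trace, trace, trace, ← (h.summable X).tsum_add (h.summable Y)]
    refine tsum_congr fun k => ?_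
    rw [mul_add, add_apply, inner_add_right]
  map_smul' c X := by
    rw [RingHom.id_apply, smul_eq_mul, trace, trace, ← tsum_mul_left]
    refine tsum_congr fun k => ?_
    rw [mul_smul_comm, smul_apply, inner_smul_right]

theorem IsTraceClass.pairing_apply (h : IsTraceClass b ρ) (X : H →L[ℂ] H) :
    h.pairing X = trace b (ρ * X) := rfl

/-- The pairing of a trace class operator with a bounded family that converges weakly. -/
theorem IsTraceClass.tendsto_trace {ι : Type*} {F : Filter ι} (h : IsTraceClass b ρ)
    {Z : ι → (H →L[ℂ] H)} {Z' : H →L[ℂ] H} {K : ℝ} (hK : ∀ i, ‖Z i‖ ≤ K)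
    (hZ : ∀ x y : H, Tendsto (fun i => inner ℂ x (Z i y)) F (𝓝 (inner ℂ x (Z' y)))) :
    Tendsto (fun i => trace b (ρ * Z i)) F (𝓝 (trace b (ρ * Z'))) := by
  obtain ⟨D, C, hD, hC, rfl⟩ := h.exists_eq_star_mul
  have e (Y : H →L[ℂ] H) : trace b (star D * C * Y)
      = ∑' k, inner ℂ (star C (b k)) (Y (star D (b k))) := by
    rw [mul_assoc, hD.trace_comm (hC.mul_right Y), trace]
    refine tsum_congr fun k => ?_
    rw [ContinuousLinearMap.star_eq_adjoint C, ContinuousLinearMap.adjoint_inner_left]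
    rfl
  simp_rw [e]
  -- Written in this way, the terms of the trace are dominated uniformly in the family.
  refine tendsto_tsum_of_dominated_convergence ((hC.star.summable_mul hD.star).mul_left K)
    (fun k => hZ _ _) (Eventually.of_forall fun i k => ?_)
  calc _ ≤ ‖star C (b k)‖ * ‖Z i (star D (b k))‖ := norm_inner_le_norm _ _
    _ ≤ ‖star C (b k)‖ * (K * ‖star D (b k)‖) := by
      gcongr
      exact (Z i).le_of_opNorm_le (hK i) _
    _ = _ := by ring

theorem re_inner_abs_nonneg (A : H →L[ℂ] H) (x : H) : 0 ≤ (inner ℂ x (CFC.abs A x)).re := by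
  rw [← norm_sq_sqrt_apply (CFC.abs_nonneg A)]
  positivity

theorem isTraceClass_of_mul_fockProj {n : ℕ} (h : ρ * fockProj b n = ρ) : IsTraceClass b ρ := by
  have h0 (k : ℕ) (hk : k ∉ Finset.range (n + 1)) : CFC.abs ρ (b k) = 0 := by
    rw [← norm_eq_zero, norm_abs_apply, ← h, mul_apply_eq_comp, fockProj_basis,
      if_neg (by simpa using hk), map_zero, norm_zero]
  rw [IsTraceClass, traceNorm, tsum_eq_sum (s := Finset.range (n + 1)) fun k hk => by
    rw [h0 k hk, inner_zero_right, Complex.zero_re, ENNReal.ofReal_zero]]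
  exact ENNReal.sum_lt_top.2 fun k _ => ENNReal.ofReal_lt_top

/-- The trace norm of `E` is `tr (E U)` for a contraction `U`. -/
theorem IsTraceClass.exists_traceNorm_eq (h : IsTraceClass b ρ) :
    ∃ U : H →L[ℂ] H, ‖U‖ ≤ 1 ∧ traceNorm b ρ = ENNReal.ofReal (trace b (ρ * U)).re := by
  obtain ⟨U, hU, hUρ⟩ := exists_contraction_mul_eq_abs ρ
  refine ⟨U, hU, ?_⟩
  have h1 : Summable fun k => (inner ℂ (b k) (CFC.abs ρ (b k))).re :=
    h.isHilbertSchmidt_sqrt.congr fun k => norm_sq_sqrt_apply (CFC.abs_nonneg ρ) _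
  have hC := h.isHilbertSchmidt_sqrt
  have h2 := hC.summable_inner hC
  rw [(CFC.sqrt_nonneg _).isSelfAdjoint.star_eq, CFC.sqrt_mul_sqrt_self _ (CFC.abs_nonneg ρ)] at h2
  rw [← h.trace_comm, hUρ, trace, Complex.re_tsum h2, traceNorm,
    ENNReal.ofReal_tsum_of_nonneg (fun k => re_inner_abs_nonneg ρ (b k)) h1]

/-- The pairing of a positive trace class operator with an operator whose sesquilinear form is
bounded relative to a diagonal weight. -/
theorem IsTraceClass.norm_trace_le (h : IsTraceClass b ρ) (hρ : 0 ≤ ρ) {W Y : H →L[ℂ] H}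
    {w : ℕ → ℝ} (hW : IsShift b 0 w W) {K : ℝ} (hY : FormBound W K Y) :
    (Summable fun k => w k ^ 2 * (inner ℂ (b k) (ρ (b k))).re) ∧
      ‖trace b (ρ * Y)‖ ≤ K * ∑' k, w k ^ 2 * (inner ℂ (b k) (ρ (b k))).re := by
  have hB := h.isHilbertSchmidt_sqrt
  rw [CFC.abs_of_nonneg ρ hρ] at hB
  set B := CFC.sqrt ρ with hBdef
  have hBs : star B = B := (CFC.sqrt_nonneg ρ).isSelfAdjoint.star_eq
  have hBB : B * B = ρ := CFC.sqrt_mul_sqrt_self ρ hρ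
  have hWB := hB.mul_left W
  have e1 : star (W * B) = B * W := by rw [star_mul, hBs, hW.star_diag]
  have e2 (k : ℕ) : ‖(B * W) (b k)‖ ^ 2 = w k ^ 2 * (inner ℂ (b k) (ρ (b k))).re := by
    rw [mul_apply_eq_comp, hW.basis, map_smul, norm_smul, mul_pow, Nat.sub_zero, hBdef,
      norm_sq_sqrt_apply hρ, Complex.norm_real, Real.norm_eq_abs, sq_abs]
  have e3 := hWB.tsum_norm_sq_star
  rw [e1] at e3
  simp_rw [e2] at e3
  have hs := hWB.star
  rw [e1] at hs
  refine ⟨hs.congr e2, ?_⟩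
  rw [e3, ← tsum_mul_left]
  have e4 : trace b (ρ * Y) = ∑' k, inner ℂ (B (b k)) (Y (B (b k))) := by
    have := hB.trace_comm (hB.mul_right Y)
    rw [hBs, ← mul_assoc, hBB] at this
    rw [this, trace]
    refine tsum_congr fun k => ?_
    have := inner_star_mul B (Y * B) (b k) (b k)
    rw [hBs, ← mul_assoc] at this
    exact this
  rw [e4]
  refine tsum_of_norm_bounded (Summable.mul_left K hWB).hasSum fun k => ?_
  refine (hY _ _).trans (le_of_eq ?_)
  rw [← sq]
  rfl

end TraceClass

/-! ### The Heisenberg semigroup is a quantum dynamical semigroup -/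

section Semigroup

variable (b : HilbertBasis ℕ ℂ H) (l : ℕ)

theorem isQuantumDynamicalSemigroup_lossEvol : IsQuantumDynamicalSemigroup b (lossEvol b l) where
  zero := lossEvol_zero b l
  add := lossEvol_add b l
  subunital t := (lossEvol_one b l t).le
  completelyPositive t m X Y := by
    rw [ContinuousLinearMap.nonneg_iff_isPositive, ContinuousLinearMap.isPositive_iff_complex]
    intro v
    have h := isCPForm_lossEvol b l t m X fun i => Y i v
    have e : inner ℂ ((∑ j, ∑ i, star (Y i) * lossEvol b l t (star (X i) * X j) * Y j) v) v
        = star (∑ j, ∑ i, inner ℂ (Y i v) (lossEvol b l t (star (X i) * X j) (Y j v))) := by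
      rw [Complex.star_def, ← inner_conj_symm]
      congr 1
      rw [sum_apply, inner_sum]
      refine Finset.sum_congr rfl fun j _ => ?_
      rw [sum_apply, inner_sum]
      refine Finset.sum_congr rfl fun i _ => ?_
      rw [mul_assoc, inner_star_mul]
      rfl
    obtain ⟨h1, h2⟩ := Complex.nonneg_iff.1 h
    rw [e]
    generalize ∑ j, ∑ i, inner ℂ (Y i v) (lossEvol b l t (star (X i) * X j) (Y j v)) = S at h1 h2
    refine ⟨Complex.ext ?_ ?_, ?_⟩
    · simp
    · simp [← h2]
    · simpa using h1
  normal X X' h t u v := tendsto_inner_lossEvol b l h t u v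
  ultraweak ρ X hρ := by
    refine hρ.tendsto_trace (K := ‖X‖) (fun t => norm_lossEvol_apply_le b l t X) fun x y => ?_
    have h := (continuous_inner_lossEvol b l X x y).tendsto 0
    rw [lossEvol_zero] at h
    exact h.mono_left nhdsWithin_le_nhds

end Semigroup

/-! ### The weak Lindblad equation -/

section Weak

variable (b : HilbertBasis ℕ ℂ H) (l : ℕ)

theorem dissipatorForm_eq (L : H →ₗ.[ℂ] H) (X : H →L[ℂ] H) (v u : (effectiveGenerator L).domain) :
    dissipatorForm L X v u = inner ℂ (L ⟨v, v.2.fst⟩) (X (L ⟨u, u.2.fst⟩))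
      - (1 / 2 : ℂ) * (inner ℂ (normalSq L ⟨v, v.2⟩) (X u)
        + inner ℂ (v : H) (X (normalSq L ⟨u, u.2⟩))) := by
  have e (w : (effectiveGenerator L).domain) :
      effectiveGenerator L w = (-(1 / 2) : ℂ) • normalSq L ⟨w, w.2⟩ := rfl
  rw [dissipatorForm, e, e, inner_smul_left, map_smul, inner_smul_right]
  simp only [map_neg, map_div₀, map_one, map_ofNat]
  ring

theorem fockProj_truncLossOp (n : ℕ) (x : H) :
    fockProj b n (truncLossOp b l n x) = truncLossOp b l n x := by
  refine eq_of_inner_basis b fun k => ?_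
  rw [inner_basis_fockProj, (isShift_truncLossOp b l n).inner_basis_apply]
  split_ifs with h
  · rfl
  · rw [truncCoeff, if_neg (by omega)]
    simp

theorem fockProj_truncNumOp (n : ℕ) (x : H) :
    fockProj b n (truncNumOp b l n x) = truncNumOp b l n x := by
  refine eq_of_inner_basis b fun k => ?_
  rw [inner_basis_fockProj, (isShift_truncNumOp b l n).inner_basis_apply]
  split_ifs with h
  · rfl
  · rw [truncCoeff, if_neg (by omega)]
    simp

/-- The shift by `l` makes the truncated jump operator exact: the jump out of level `k + l` lands on
level `k`. -/
theorem truncLossOp_eq_fockProj (m : ℕ) (ψ : (lossOp b l).domain) :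
    truncLossOp b l (m + l) ψ = fockProj b m (lossOp b l ψ) := by
  refine eq_of_inner_basis b fun k => ?_
  rw [inner_basis_fockProj, (isShift_truncLossOp b l _).inner_basis_apply, inner_basis_lossOp,
    truncCoeff]
  split_ifs with h1 h2 h2
  · rfl
  · omega
  · omega
  · simp

theorem truncNumOp_eq_fockProj (n : ℕ) (ψ : (normalSq (lossOp b l)).domain) :
    truncNumOp b l n ψ = fockProj b n (normalSq (lossOp b l) ψ) := by
  refine eq_of_inner_basis b fun k => ?_
  rw [inner_basis_fockProj, (isShift_truncNumOp b l _).inner_basis_apply, inner_basis_normalSq,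
    truncCoeff, add_zero]
  split_ifs with h1
  · rw [lossCoeff_sq, Complex.ofReal_natCast]
  · simp

theorem inner_truncGen_corner (n : ℕ) (Y : H →L[ℂ] H) (v u : H) :
    inner ℂ v (truncGen b l n (corner b n Y) u)
      = inner ℂ (truncLossOp b l n v) (Y (truncLossOp b l n u))
        - (1 / 2 : ℂ) * (inner ℂ (truncNumOp b l n v) (Y (fockProj b n u))
          + inner ℂ (fockProj b n v) (Y (truncNumOp b l n u))) := by
  rw [inner_truncGen, inner_corner, inner_corner, inner_corner, fockProj_truncLossOp,
    fockProj_truncLossOp, fockProj_truncNumOp, fockProj_truncNumOp]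

theorem continuous_inner_lossEvol_toNNReal (X : H →L[ℂ] H) (x y : H) :
    Continuous fun s : ℝ => inner ℂ x (lossEvol b l s.toNNReal X y) :=
  (continuous_inner_lossEvol b l X x y).comp continuous_real_toNNReal

theorem continuous_dissipatorForm_lossEvol (X : H →L[ℂ] H)
    (v u : (effectiveGenerator (lossOp b l)).domain) :
    Continuous fun s : ℝ => dissipatorForm (lossOp b l) (lossEvol b l s.toNNReal X) v u := by
  simp_rw [dissipatorForm_eq]
  exact (continuous_inner_lossEvol_toNNReal b l X _ _).sub (continuous_const.mul
    ((continuous_inner_lossEvol_toNNReal b l X _ _).add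
      (continuous_inner_lossEvol_toNNReal b l X _ _)))

theorem inner_fockProj_lossEvol_eq (n : ℕ) (X : H →L[ℂ] H) (t : ℝ≥0) (v u : H) :
    inner ℂ (fockProj b n v) (lossEvol b l t X (fockProj b n u))
      = inner ℂ (fockProj b n v) (X (fockProj b n u))
        + ∫ s in (0 : ℝ)..t, inner ℂ v
          (truncGen b l n (corner b n (lossEvol b l s.toNNReal X)) u) := by
  have hd (s : ℝ) := hasDerivAt_inner_truncEvol b l n (corner b n X) 1 v u s
  have hc : Continuous fun s : ℝ =>
      inner ℂ v (truncGen b l n (truncEvol b l n s (corner b n X)) u) :=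
    continuous_const.inner (((truncGen b l n).continuous.comp
      (continuous_truncEvol_apply b l n _)).clm_apply continuous_const)
  have h := intervalIntegral.integral_eq_sub_of_hasDerivAt (fun s _ => hd s)
    (hc.intervalIntegrable 0 t)
  rw [← inner_corner, ← inner_corner, corner_lossEvol]
  have h2 : ∫ s in (0 : ℝ)..t, inner ℂ v
      (truncGen b l n (corner b n (lossEvol b l s.toNNReal X)) u)
      = ∫ s in (0 : ℝ)..t, inner ℂ v (truncGen b l n (truncEvol b l n s (corner b n X)) u) := by
    refine intervalIntegral.integral_congr fun s hs => ?_
    rw [Set.uIcc_of_le t.coe_nonneg] at hs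
    rw [corner_lossEvol, Real.coe_toNNReal s hs.1]
  rw [h2]
  refine (sub_eq_iff_eq_add'.1 h.symm).trans ?_
  rw [truncEvol_zero]
  rfl

/-- Each corner satisfies its integrated equation exactly; letting its size tend to infinity gives
the weak equation, by dominated convergence in time. -/
theorem lossEvol_weak (u v : (effectiveGenerator (lossOp b l)).domain) (X : H →L[ℂ] H) (t : ℝ≥0) :
    inner ℂ (v : H) (lossEvol b l t X u) = inner ℂ (v : H) (X u)
      + ∫ s in (0 : ℝ)..t, dissipatorForm (lossOp b l) (lossEvol b l s.toNNReal X) v u := by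
  have hinner {x y : ℕ → H} {x' y' : H} (hx : Tendsto x atTop (𝓝 x')) (hy : Tendsto y atTop (𝓝 y'))
      (Y : H →L[ℂ] H) : Tendsto (fun n => inner ℂ (x n) (Y (y n))) atTop (𝓝 (inner ℂ x' (Y y'))) :=
    hx.inner ((Y.continuous.tendsto _).comp hy)
  have hl := tendsto_add_atTop_nat l
  have hP (x : H) : Tendsto (fun m => fockProj b (m + l) x) atTop (𝓝 x) :=
    (tendsto_fockProj b x).comp hl
  have h1 := hinner (hP v) (hP u) (lossEvol b l t X)
  have h2 := hinner (hP v) (hP u) X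
  have hLn (w : (effectiveGenerator (lossOp b l)).domain) (m : ℕ) : truncLossOp b l (m + l) w
      = fockProj b m (lossOp b l ⟨w, w.2.fst⟩) := truncLossOp_eq_fockProj b l m ⟨w, w.2.fst⟩
  have hAn (w : (effectiveGenerator (lossOp b l)).domain) (m : ℕ) : truncNumOp b l (m + l) w
      = fockProj b (m + l) (normalSq (lossOp b l) ⟨w, w.2⟩) :=
    truncNumOp_eq_fockProj b l (m + l) ⟨w, w.2⟩
  set Lv := lossOp b l ⟨v, v.2.fst⟩
  set Lu := lossOp b l ⟨u, u.2.fst⟩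
  set Av := normalSq (lossOp b l) ⟨v, v.2⟩
  set Au := normalSq (lossOp b l) ⟨u, u.2⟩
  have hle {x y x' y' : H} (hx : ‖x‖ ≤ ‖x'‖) (hy : ‖y‖ ≤ ‖y'‖) (s : ℝ) :
      ‖inner ℂ x (lossEvol b l s.toNNReal X y)‖ ≤ ‖X‖ * (‖x'‖ * ‖y'‖) := by
    refine (formBound_one _ x y).trans ?_
    simp only [one_apply_eq_self]
    gcongr
    exact norm_lossEvol_apply_le b l _ X
  have hPn (n : ℕ) (x : H) := norm_fockProj_apply_le b n x
  have h3 : Tendsto (fun m => ∫ s in (0 : ℝ)..t, inner ℂ (v : H)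
      (truncGen b l (m + l) (corner b (m + l) (lossEvol b l s.toNNReal X)) u)) atTop
      (𝓝 (∫ s in (0 : ℝ)..t, dissipatorForm (lossOp b l) (lossEvol b l s.toNNReal X) v u)) := by
    refine intervalIntegral.tendsto_integral_filter_of_dominated_convergence
      (fun _ => ‖X‖ * (‖Lv‖ * ‖Lu‖) + 1 / 2 * (‖X‖ * (‖Av‖ * ‖(u : H)‖)
        + ‖X‖ * (‖(v : H)‖ * ‖Au‖))) (Eventually.of_forall fun m => ?_)
      (Eventually.of_forall fun m => Eventually.of_forall fun s _ => ?_)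
      intervalIntegrable_const (Eventually.of_forall fun s _ => ?_)
    · simp_rw [inner_truncGen_corner]
      exact ((continuous_inner_lossEvol_toNNReal b l X _ _).sub (continuous_const.mul
        ((continuous_inner_lossEvol_toNNReal b l X _ _).add
          (continuous_inner_lossEvol_toNNReal b l X _ _)))).aestronglyMeasurable
    · rw [inner_truncGen_corner, hLn, hLn, hAn, hAn]
      refine (norm_sub_le _ _).trans (add_le_add (hle (hPn _ _) (hPn _ _) s) ?_)
      rw [norm_mul, show ‖(1 / 2 : ℂ)‖ = 1 / 2 by norm_num]
      exact mul_le_mul_of_nonneg_left ((norm_add_le _ _).trans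
        (add_le_add (hle (hPn _ _) (hPn _ _) s) (hle (hPn _ _) (hPn _ _) s))) (by norm_num)
    · simp_rw [inner_truncGen_corner, hLn, hAn]
      rw [dissipatorForm_eq]
      exact (hinner (tendsto_fockProj b _) (tendsto_fockProj b _) _).sub
        (Tendsto.const_mul _ ((hinner (hP _) (hP _) _).add (hinner (hP _) (hP _) _)))
  refine tendsto_nhds_unique h1 ((h2.add h3).congr fun m => ?_)
  exact (inner_fockProj_lossEvol_eq b l (m + l) X t v u).symm

theorem isLindbladSemigroup_lossEvol : IsLindbladSemigroup b (lossOp b l) (lossEvol b l) where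
  isQuantumDynamicalSemigroup := isQuantumDynamicalSemigroup_lossEvol b l
  integrable u v X t := (continuous_dissipatorForm_lossEvol b l X v u).intervalIntegrable 0 t
  weak := lossEvol_weak b l

/-! ### Uniqueness -/

theorem dissipatorForm_basis (Y : H →L[ℂ] H) {n i j : ℕ} (hi : i ≤ n) (hj : j ≤ n)
    (h : b i ∈ (effectiveGenerator (lossOp b l)).domain)
    (h' : b j ∈ (effectiveGenerator (lossOp b l)).domain) :
    dissipatorForm (lossOp b l) Y ⟨b i, h⟩ ⟨b j, h'⟩
      = inner ℂ (b i) (truncGen b l n (corner b n Y) (b j)) := by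
  have hL {k : ℕ} (hk : k ≤ n) (hd : b k ∈ (lossOp b l).domain) :
      lossOp b l ⟨b k, hd⟩ = truncLossOp b l n (b k) := by
    obtain ⟨_, e⟩ := lossOp_basis b l k
    rw [e, (isShift_truncLossOp b l n).basis, truncCoeff, if_pos hk]
  have hA {k : ℕ} (hk : k ≤ n) (hd : b k ∈ (normalSq (lossOp b l)).domain) :
      normalSq (lossOp b l) ⟨b k, hd⟩ = truncNumOp b l n (b k) := by
    rw [truncNumOp_eq_fockProj b l n ⟨b k, hd⟩]
    obtain ⟨_, e⟩ := normalSq_basis b l k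
    rw [e, map_smul, fockProj_basis, if_pos hk]
  have hAi : normalSq (lossOp b l) ⟨b i, h⟩ = truncNumOp b l n (b i) := hA hi h
  have hAj : normalSq (lossOp b l) ⟨b j, h'⟩ = truncNumOp b l n (b j) := hA hj h'
  rw [dissipatorForm_eq, inner_truncGen_corner, hL hi, hL hj, fockProj_basis, fockProj_basis,
    if_pos hi, if_pos hj, ← hAi, ← hAj]

/-- The corners of a solution solve the finite system of linear differential equations defined by
the truncated generator, and this determines them. -/
theorem IsLindbladSemigroup.eq_lossEvol {𝒯 : ℝ≥0 → (H →L[ℂ] H) →ₗ[ℂ] (H →L[ℂ] H)}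
    (h : IsLindbladSemigroup b (lossOp b l) 𝒯) : 𝒯 = lossEvol b l := by
  funext t
  refine LinearMap.ext fun X => corner_ext b fun n => ?_
  rw [corner_lossEvol]
  have hdom (k : ℕ) : b k ∈ (effectiveGenerator (lossOp b l)).domain := (normalSq_basis b l k).fst
  have hint (i j : ℕ) := h.integrable ⟨b j, hdom j⟩ ⟨b i, hdom i⟩ X
  have hweak (i j : ℕ) := h.weak ⟨b j, hdom j⟩ ⟨b i, hdom i⟩ X
  -- No continuity in time is assumed beyond `t = 0`; it follows from the integral equation.
  have hcont (i j : ℕ) : Continuous fun s : ℝ => inner ℂ (b i) (𝒯 s.toNNReal X (b j)) := by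
    have h1 : ContinuousOn (fun s : ℝ => inner ℂ (b i) (𝒯 s.toNNReal X (b j))) (Set.Ici 0) := by
      intro s hs
      have h2 := intervalIntegral.continuousOn_primitive_interval'
        (hint i j (s + 1).toNNReal) Set.left_mem_uIcc
      have hs1 : ((s + 1).toNNReal : ℝ) = s + 1 := Real.coe_toNNReal _ (by linarith [hs.out])
      rw [hs1, Set.uIcc_of_le (by linarith [hs.out])] at h2
      have h3 : ContinuousWithinAt (fun s : ℝ => inner ℂ (b i) (𝒯 s.toNNReal X (b j)))
          (Set.Icc 0 (s + 1)) s := by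
        refine ((continuousWithinAt_const (b := inner ℂ (b i) (X (b j)))).add
          (h2 s ⟨hs, by linarith⟩)).congr (fun r hr => ?_) ?_
        · have := hweak i j r.toNNReal
          rwa [Real.coe_toNNReal _ hr.1] at this
        · have := hweak i j s.toNNReal
          rwa [Real.coe_toNNReal _ hs] at this
      refine h3.mono_of_mem_nhdsWithin ?_
      filter_upwards [self_mem_nhdsWithin, mem_nhdsWithin_of_mem_nhds (Iio_mem_nhds (lt_add_one s))]
        with r h4 h5
      exact ⟨h4, le_of_lt h5⟩
    have h4 : (fun s : ℝ => inner ℂ (b i) (𝒯 s.toNNReal X (b j)))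
        = fun s : ℝ => inner ℂ (b i) (𝒯 (max s 0).toNNReal X (b j)) := by
      funext s
      congr 4
      rcases le_total s 0 with hs | hs
      · rw [max_eq_right hs, Real.toNNReal_zero, Real.toNNReal_of_nonpos hs]
      · rw [max_eq_left hs]
    rw [h4]
    exact h1.comp_continuous (by fun_prop) fun s => le_max_right s 0
  set y : ℝ → (H →L[ℂ] H) := fun s => corner b n (𝒯 s.toNNReal X) with hy
  have hycont : Continuous y := by
    simp_rw [hy, corner_eq_sum]
    exact continuous_finsetSum _ fun i _ => continuous_finsetSum _ fun j _ =>
      (hcont i j).smul continuous_const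
  have hder (s : ℝ) (hs : 0 ≤ s) : HasDerivWithinAt y (truncGen b l n (y s)) (Set.Ici s) s := by
    have e1 : truncGen b l n (y s) = ∑ i ∈ Finset.range (n + 1), ∑ j ∈ Finset.range (n + 1),
        inner ℂ (b i) (truncGen b l n (y s) (b j)) • matrixUnit b i j := by
      rw [← corner_eq_sum]
      have := congrArg (fun Φ : (H →L[ℂ] H) →L[ℂ] (H →L[ℂ] H) => Φ (y s))
        (semiconjBy_corner_truncGen b l (le_refl n)).eq
      refine Eq.trans ?_ this.symm
      change _ = truncGen b l n (corner b n (corner b n _))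
      rw [corner_corner b le_rfl]
    rw [e1]
    simp_rw [hy, corner_eq_sum b n (𝒯 _ X)]
    refine HasDerivWithinAt.fun_sum fun i hi => HasDerivWithinAt.fun_sum fun j hj => ?_
    refine HasDerivWithinAt.smul_const ?_ _
    have hi' : i ≤ n := Nat.lt_succ_iff.1 (Finset.mem_range.1 hi)
    have hj' : j ≤ n := Nat.lt_succ_iff.1 (Finset.mem_range.1 hj)
    have hg : Continuous fun r => inner ℂ (b i) (truncGen b l n (y r) (b j)) :=
      continuous_const.inner (((truncGen b l n).continuous.comp hycont).clm_apply continuous_const)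
    have h5 := ((hg.integral_hasStrictDerivAt 0 s).hasDerivAt.const_add
      (inner ℂ (b i) (X (b j)))).hasDerivWithinAt (s := Set.Ici s)
    have h6 (r : ℝ) (hr : 0 ≤ r) : inner ℂ (b i) (𝒯 r.toNNReal X (b j))
        = inner ℂ (b i) (X (b j))
          + ∫ q in (0 : ℝ)..r, inner ℂ (b i) (truncGen b l n (y q) (b j)) := by
      have := hweak i j r.toNNReal
      rw [Real.coe_toNNReal _ hr] at this
      simp_rw [dissipatorForm_basis b l _ hi' hj'] at this
      exact this
    rw [← corner_eq_sum]
    exact h5.congr (fun r hr => h6 r (hs.trans hr)) (h6 s hs)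
  have huniq := ODE_solution_unique (v := fun _ => truncGen b l n) (K := ‖truncGen b l n‖₊)
    (a := 0) (b := t) (f := y) (g := fun s => truncEvol b l n s (corner b n X))
    (fun _ => (truncGen b l n).lipschitz) hycont.continuousOn (fun s hs => hder s hs.1)
    (continuous_truncEvol_apply b l n _).continuousOn
    (fun s _ => (hasDerivAt_truncEvol b l n _ s).hasDerivWithinAt)
    (by simp only [hy, Real.toNNReal_zero, h.isQuantumDynamicalSemigroup.zero, truncEvol_zero]; rfl)
  have := huniq ⟨t.coe_nonneg, le_rfl⟩
  simp only [hy, Real.toNNReal_coe] at this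
  exact this

end Weak

/-! ### Operators supported on the truncated space -/

section Supported

variable {b : HilbertBasis ℕ ℂ H} {ρ : H →L[ℂ] H} {n : ℕ}

theorem mul_fockProj_of_corner_eq (h : corner b n ρ = ρ) : ρ * fockProj b n = ρ := by
  rw [corner_apply] at h
  rw [← h, mul_assoc, fockProj_mul_fockProj b le_rfl]

theorem isTraceClass_of_corner_eq (h : corner b n ρ = ρ) : IsTraceClass b ρ :=
  isTraceClass_of_mul_fockProj (mul_fockProj_of_corner_eq h)

/-- An operator on the truncated space only sees corners. -/
theorem trace_mul_corner (h : corner b n ρ = ρ) (X : H →L[ℂ] H) :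
    trace b (ρ * corner b n X) = trace b (ρ * X) := by
  have hP := mul_fockProj_of_corner_eq h
  have ht := isTraceClass_of_corner_eq h
  conv_rhs => rw [← h, corner_apply, mul_assoc (fockProj b n), hP, ht.trace_mul_mul_comm]
  rw [corner_apply, mul_assoc, ← mul_assoc ρ, hP]

theorem inner_basis_eq_zero (h : corner b n ρ = ρ) {i j : ℕ} (hij : ¬(i ≤ n ∧ j ≤ n)) :
    inner ℂ (b i) (ρ (b j)) = 0 := by
  rw [← h, inner_corner, fockProj_basis, fockProj_basis]
  by_cases hi : i ≤ n
  · rw [if_neg fun hj => hij ⟨hi, hj⟩, map_zero, inner_zero_right]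
  · rw [if_neg hi, inner_zero_left]

theorem IsShift.inner_mul_mul {d e : ℕ → ℝ} {A B : H →L[ℂ] H} (hA : IsShift b 0 d A)
    (hB : IsShift b 0 e B) (X : H →L[ℂ] H) (i j : ℕ) :
    inner ℂ (b i) ((A * X * B) (b j)) = d i * e j * inner ℂ (b i) (X (b j)) := by
  rw [mul_apply_eq_comp, mul_apply_eq_comp, hB.basis, map_smul, map_smul, inner_smul_right,
    hA.inner_basis_apply]
  simp only [add_zero, Nat.sub_zero]
  ring

/-- On the truncated space, the bounded operator `weightOp` agrees with `Λ ^ 2`, so that the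
operator `σ` in the definition of the weighted norm is `Λₙ² ρ Λₙ²`. -/
theorem weightedTraceNorm_eq (l : ℕ) (h : corner b n ρ = ρ) :
    weightedTraceNorm b (refOp b l) 2 ρ
      = traceNorm b (weightOp b l n * ρ * weightOp b l n) := by
  obtain ⟨R, hR, hinv⟩ := exists_isBoundedInverse_refOp_sq b l
  have hW := isShift_weightOp b l n
  have hne (k : ℕ) : (refCoeff l k : ℂ) ≠ 0 :=
    Complex.ofReal_ne_zero.2 (zero_lt_one.trans_le (one_le_refCoeff l k)).ne'
  have hw {k : ℕ} (hk : k ≤ n) : (1 + truncCoeff l n k ^ 2) ^ 2 = refCoeff l k ^ 2 := by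
    rw [truncCoeff, if_pos hk, lossCoeff_sq, refCoeff]
  refine le_antisymm (iInf_le_of_le R (iInf_le_of_le hinv (iInf_le_of_le _ (iInf_le _ ?_)))) ?_
  · refine ext_matrix b fun i j => ?_
    rw [hR.inner_mul_mul hR, hW.inner_mul_mul hW]
    by_cases hij : i ≤ n ∧ j ≤ n
    · have h1 := hne i
      have h2 := hne j
      rw [hw hij.1, hw hij.2]
      push_cast
      field_simp
    · rw [inner_basis_eq_zero h hij, mul_zero, mul_zero]
  · refine le_iInf fun R' => le_iInf fun hR' => le_iInf fun σ => le_iInf fun hσ => ?_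
    obtain rfl := hinv.unique hR'
    refine (congrArg (traceNorm b) (ext_matrix b fun i j => ?_)).le
    have e := hR.inner_mul_mul hR σ i j
    rw [← hσ] at e
    have h1 := hne i
    have h2 := hne j
    rw [hW.inner_mul_mul hW]
    by_cases hij : i ≤ n ∧ j ≤ n
    · rw [e, hw hij.1, hw hij.2]
      push_cast
      field_simp
    · rw [inner_basis_eq_zero h hij] at e ⊢
      push_cast at e
      rw [mul_zero]
      exact ((mul_eq_zero.1 e.symm).resolve_left
        (mul_ne_zero (inv_ne_zero (pow_ne_zero 2 h1)) (inv_ne_zero (pow_ne_zero 2 h2)))).symm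

theorem weightedTraceNorm_eq_ofReal (l : ℕ) (h : corner b n ρ = ρ) (hρ : 0 ≤ ρ) :
    weightedTraceNorm b (refOp b l) 2 ρ = ENNReal.ofReal
      (∑' k, ((1 + truncCoeff l n k ^ 2) ^ 2) ^ 2 * (inner ℂ (b k) (ρ (b k))).re) := by
  have hW := isShift_weightOp b l n
  have ht := isTraceClass_of_corner_eq h
  have hpos : 0 ≤ weightOp b l n * ρ * weightOp b l n := by
    have := star_left_conjugate_nonneg hρ (weightOp b l n)
    rwa [hW.star_diag] at this
  have hdiag (k : ℕ) : (inner ℂ (b k) ((weightOp b l n * ρ * weightOp b l n) (b k))).re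
      = ((1 + truncCoeff l n k ^ 2) ^ 2) ^ 2 * (inner ℂ (b k) (ρ (b k))).re := by
    rw [hW.inner_mul_mul hW, ← Complex.ofReal_mul, Complex.re_ofReal_mul, ← sq]
  have hnn (k : ℕ) : 0 ≤ (inner ℂ (b k) (ρ (b k))).re := by
    have := re_inner_abs_nonneg ρ (b k)
    rwa [CFC.abs_of_nonneg ρ hρ] at this
  rw [weightedTraceNorm_eq l h, traceNorm, CFC.abs_of_nonneg _ hpos]
  simp_rw [hdiag]
  refine (ENNReal.ofReal_tsum_of_nonneg (fun k => mul_nonneg (by positivity) (hnn k)) ?_).symm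
  have hF : FormBound (weightOp b l n) 0 (0 : H →L[ℂ] H) := fun v u => by simp
  exact (ht.norm_trace_le hρ hW hF).1

end Supported

/-! ### The scheme in the Schrödinger picture -/

section Scheme

variable {b : HilbertBasis ℕ ℂ H} {ρ : H →L[ℂ] H} {n : ℕ}

theorem IsTraceClass.trace_add_mul {ρ' : H →L[ℂ] H} (h : IsTraceClass b ρ) (h' : IsTraceClass b ρ')
    (X : H →L[ℂ] H) : trace b ((ρ + ρ') * X) = trace b (ρ * X) + trace b (ρ' * X) := by
  rw [trace, trace, trace, ← (h.summable X).tsum_add (h'.summable X)]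
  refine tsum_congr fun k => ?_
  rw [add_mul, add_apply, inner_add_right]

theorem corner_mul_mul_star {s : ℕ} {d : ℕ → ℝ} {M : H →L[ℂ] H} (hM : IsShift b s d M)
    (h : corner b n ρ = ρ) : corner b n (M * ρ * star M) = M * ρ * star M := by
  have h1 := hM.fockProj_mul_mul n
  have h2 := congrArg star h1
  simp only [star_mul, star_fockProj, ← mul_assoc] at h2
  rw [corner_apply] at h
  rw [← h, corner_apply]
  calc _ = (fockProj b n * M * fockProj b n) * ρ * (fockProj b n * star M * fockProj b n) := by
        simp only [mul_assoc]
    _ = _ := by rw [h1, h2]; simp only [mul_assoc]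

theorem corner_scheme (l : ℕ) (Δt : ℝ) (h : corner b n ρ = ρ) :
    corner b n (scheme b l n Δt ρ) = scheme b l n Δt ρ := by
  rw [scheme, map_add, corner_mul_mul_star (isShift_schemeM0 b l n Δt) h,
    corner_mul_mul_star (isShift_schemeM1 b l n Δt) h]

theorem trace_scheme_mul (l : ℕ) (Δt : ℝ) (h : corner b n ρ = ρ) (X : H →L[ℂ] H) :
    trace b (scheme b l n Δt ρ * X) = trace b (ρ * schemeDual b l n Δt X) := by
  have ht := isTraceClass_of_corner_eq h
  have e {s : ℕ} {d : ℕ → ℝ} {M : H →L[ℂ] H} (hM : IsShift b s d M) :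
      trace b (M * ρ * star M * X) = trace b (ρ * (star M * X * M)) := by
    rw [mul_assoc (M * ρ), ht.trace_mul_mul_comm]
  have h0 := isShift_schemeM0 b l n Δt
  have h1 := isShift_schemeM1 b l n Δt
  rw [scheme, (isTraceClass_of_corner_eq (corner_mul_mul_star h0 h)).trace_add_mul
    (isTraceClass_of_corner_eq (corner_mul_mul_star h1 h)), e h0, e h1, schemeDual_apply]
  exact (map_add ht.pairing _ _).symm

theorem corner_iterate_scheme (l : ℕ) (Δt : ℝ) (h : corner b n ρ = ρ) (N : ℕ) :
    corner b n ((scheme b l n Δt)^[N] ρ) = (scheme b l n Δt)^[N] ρ := by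
  induction N with
  | zero => exact h
  | succ N ih =>
    rw [Function.iterate_succ_apply']
    exact corner_scheme l Δt ih

theorem trace_iterate_scheme_mul (l : ℕ) (Δt : ℝ) (h : corner b n ρ = ρ) (N : ℕ)
    (X : H →L[ℂ] H) :
    trace b ((scheme b l n Δt)^[N] ρ * X) = trace b (ρ * (schemeDual b l n Δt ^ N) X) := by
  induction N generalizing X with
  | zero => rfl
  | succ N ih =>
    rw [Function.iterate_succ_apply', trace_scheme_mul l Δt (corner_iterate_scheme l Δt h N), ih,
      pow_succ]
    rfl

end Scheme

/-! ### The predual state -/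

section Predual

variable {b : HilbertBasis ℕ ℂ H} {ρ : H →L[ℂ] H} {n : ℕ}

theorem trace_mul_matrixUnit (ρ : H →L[ℂ] H) (i j : ℕ) :
    trace b (ρ * matrixUnit b i j) = inner ℂ (b j) (ρ (b i)) := by
  rw [trace, tsum_eq_single j fun k hk => ?_]
  · rw [mul_apply_eq_comp, matrixUnit_apply, inner_basis, if_pos rfl, one_smul]
  · rw [mul_apply_eq_comp, matrixUnit_apply, inner_basis, if_neg (Ne.symm hk), zero_smul, map_zero,
      inner_zero_right]

theorem IsPredualState.unique {𝒯 : ℝ≥0 → (H →L[ℂ] H) →ₗ[ℂ] (H →L[ℂ] H)} {t : ℝ≥0}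
    {ρ₁ ρ₂ : H →L[ℂ] H} (h₁ : IsPredualState b 𝒯 t ρ ρ₁) (h₂ : IsPredualState b 𝒯 t ρ ρ₂) :
    ρ₁ = ρ₂ :=
  ext_matrix b fun i j => by
    rw [← trace_mul_matrixUnit, ← trace_mul_matrixUnit, h₁.2, h₂.2]

theorem corner_matrixUnit {i j : ℕ} (hi : i ≤ n) (hj : j ≤ n) :
    corner b n (matrixUnit b i j) = matrixUnit b i j := by
  refine ext_matrix b fun p q => ?_
  simp only [inner_corner, fockProj_basis]
  split_ifs with hp hq hq
  · rfl
  · rw [map_zero, inner_zero_right, matrixUnit_apply, inner_basis, if_neg (by omega), zero_smul,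
      inner_zero_right]
  all_goals
    rw [inner_zero_left, matrixUnit_apply, inner_smul_right, inner_basis b p, if_neg (by omega),
      mul_zero]

/-- The functional `X ↦ tr (ρ 𝒯_t(X))` only depends on the corner of `X`, hence it is represented
by an operator on the truncated space. -/
theorem exists_isPredualState_lossEvol (l : ℕ) (t : ℝ≥0) (h : corner b n ρ = ρ) :
    ∃ ρt, IsPredualState b (lossEvol b l) t ρ ρt ∧ corner b n ρt = ρt := by
  have ht := isTraceClass_of_corner_eq h
  set ρt : H →L[ℂ] H := ∑ i ∈ Finset.range (n + 1), ∑ j ∈ Finset.range (n + 1),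
    trace b (ρ * lossEvol b l t (matrixUnit b j i)) • matrixUnit b i j with hρt
  have hc : corner b n ρt = ρt := by
    rw [hρt, map_sum]
    refine Finset.sum_congr rfl fun i hi => ?_
    rw [map_sum]
    refine Finset.sum_congr rfl fun j hj => ?_
    rw [map_smul, corner_matrixUnit (Finset.mem_range_succ_iff.1 hi)
      (Finset.mem_range_succ_iff.1 hj)]
  have htt := isTraceClass_of_corner_eq hc
  have hentry {p q : ℕ} (hp : p ∈ Finset.range (n + 1)) (hq : q ∈ Finset.range (n + 1)) :
      inner ℂ (b p) (ρt (b q)) = trace b (ρ * lossEvol b l t (matrixUnit b q p)) := by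
    rw [hρt, sum_apply, inner_sum, Finset.sum_eq_single_of_mem p hp fun i _ hi => ?_, sum_apply,
      inner_sum, Finset.sum_eq_single_of_mem q hq fun j _ hj => ?_]
    · rw [smul_apply, matrixUnit_apply, inner_smul_right, inner_smul_right, inner_basis,
        inner_basis, if_pos rfl, if_pos rfl, mul_one, mul_one]
    · rw [smul_apply, matrixUnit_apply, inner_basis, if_neg hj, zero_smul, smul_zero,
        inner_zero_right]
    · rw [sum_apply, inner_sum]
      refine Finset.sum_eq_zero fun j _ => ?_
      rw [smul_apply, matrixUnit_apply, inner_smul_right, inner_smul_right, inner_basis b p,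
        if_neg (Ne.symm hi), mul_zero, mul_zero]
  refine ⟨ρt, ⟨htt, fun X => ?_⟩, hc⟩
  have hcorner : trace b (ρ * lossEvol b l t X) = trace b (ρ * lossEvol b l t (corner b n X)) := by
    rw [← trace_mul_corner h, corner_lossEvol, ← corner_corner b le_rfl X, ← corner_lossEvol,
      trace_mul_corner h, corner_corner b le_rfl]
  rw [hcorner, ← trace_mul_corner hc, ← htt.pairing_apply, ← ht.pairing_apply, corner_eq_sum,
    map_sum, map_sum, map_sum]
  refine Finset.sum_congr rfl fun i hi => ?_
  rw [map_sum, map_sum, map_sum]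
  refine Finset.sum_congr rfl fun j hj => ?_
  rw [map_smul, map_smul, map_smul, htt.pairing_apply, ht.pairing_apply, trace_mul_matrixUnit,
    hentry hj hi]

end Predual

/-! ### The error bound -/

section ErrorBound

variable {b : HilbertBasis ℕ ℂ H} {ρ : H →L[ℂ] H} {n : ℕ}

/-- The trace norm of the error is its pairing with a contraction `U`, which is the pairing of `ρ`
with the error of the dual scheme started at `U`. -/
theorem traceNorm_sub_iterate_scheme_le (l : ℕ) {t : ℝ≥0} {ρt : H →L[ℂ] H}
    (hst : IsPredualState b (lossEvol b l) t ρ ρt) (hc : corner b n ρt = ρt)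
    (h : corner b n ρ = ρ) (hρ : 0 ≤ ρ) {Δt : ℝ} (hΔt : 0 ≤ Δt) {N : ℕ} (hN : Δt * N = t) :
    traceNorm b (ρt - (scheme b l n Δt)^[N] ρ)
      ≤ ENNReal.ofReal (9 * t) * weightedTraceNorm b (refOp b l) 2 ρ * ENNReal.ofReal Δt := by
  have ht := isTraceClass_of_corner_eq h
  set σ := (scheme b l n Δt)^[N] ρ with hσ
  have hcσ : corner b n σ = σ := corner_iterate_scheme l Δt h N
  have hcE : corner b n (ρt - σ) = ρt - σ := by rw [map_sub, hc, hcσ]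
  have hE := isTraceClass_of_corner_eq hcE
  obtain ⟨U, hU, hUE⟩ := hE.exists_traceNorm_eq
  have hNt : (N : ℝ) * Δt = t := by rw [mul_comm, hN]
  have e1 : trace b ((ρt - σ) * U)
      = trace b (ρ * (truncEvol b l n (N * Δt) U - (schemeDual b l n Δt ^ N) U)) := by
    have e2 := hE.trace_add_mul (isTraceClass_of_corner_eq hcσ) U
    rw [sub_add_cancel, hst.2, ← trace_mul_corner h, corner_lossEvol', trace_mul_corner h, hσ,
      trace_iterate_scheme_mul l Δt h] at e2
    rw [← ht.pairing_apply, map_sub, ht.pairing_apply, ht.pairing_apply, hNt]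
    exact eq_sub_of_add_eq e2.symm
  have hF := formBound_truncEvol_sub_schemeDual_pow b l n hΔt (X := U) (B := 1) N fun s hs =>
    (norm_truncEvol_apply_le b l n hs.1 U).trans hU
  have h1 := (ht.norm_trace_le hρ (isShift_weightOp b l n) hF).2
  rw [hUE, e1, weightedTraceNorm_eq_ofReal l h hρ, ← ENNReal.ofReal_mul (by positivity),
    ← ENNReal.ofReal_mul' hΔt]
  refine ENNReal.ofReal_le_ofReal (((Complex.re_le_norm _).trans h1).trans_eq ?_)
  rw [hNt]
  ring

end ErrorBound

end PhotonLoss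

end

theorem mainTheorem7 {H : Type*} [NormedAddCommGroup H] [InnerProductSpace ℂ H] [CompleteSpace H]
    (b : HilbertBasis ℕ ℂ H) (l : ℕ) (T : ℝ≥0) (hT : 0 < T) :
    ∃ 𝒯 : ℝ≥0 → (H →L[ℂ] H) →ₗ[ℂ] (H →L[ℂ] H),
      (PhotonLoss.IsLindbladSemigroup b (PhotonLoss.lossOp b l) 𝒯 ∧
        ∀ 𝒯', PhotonLoss.IsLindbladSemigroup b (PhotonLoss.lossOp b l) 𝒯' → 𝒯' = 𝒯) ∧
      ∃ C : ℝ, 0 < C ∧ ∀ (n : ℕ) (ρ₀ : H →L[ℂ] H),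
        PhotonLoss.IsTraceClass b ρ₀ → 0 ≤ ρ₀ →
        PhotonLoss.fockProj b n * ρ₀ * PhotonLoss.fockProj b n = ρ₀ →
        PhotonLoss.weightedTraceNorm b (PhotonLoss.refOp b l) 2 ρ₀ < ∞ ∧
        ∃ ρT : H →L[ℂ] H,
          (PhotonLoss.IsPredualState b 𝒯 T ρ₀ ρT ∧
            ∀ ρT', PhotonLoss.IsPredualState b 𝒯 T ρ₀ ρT' → ρT' = ρT) ∧
          ∀ (Δt : ℝ) (N : ℕ), 0 < Δt → Δt * N = T →
            PhotonLoss.traceNorm b (ρT - (PhotonLoss.scheme b l n Δt)^[N] ρ₀) ≤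
              ENNReal.ofReal C * PhotonLoss.weightedTraceNorm b (PhotonLoss.refOp b l) 2 ρ₀ *
                ENNReal.ofReal Δt := by
  refine ⟨PhotonLoss.lossEvol b l, ⟨PhotonLoss.isLindbladSemigroup_lossEvol b l,
    fun _ h => h.eq_lossEvol b l⟩, 9 * T, by positivity, fun n ρ₀ _ hρ₀ h => ?_⟩
  have hc : PhotonLoss.corner b n ρ₀ = ρ₀ := h
  obtain ⟨ρT, hst, hcT⟩ := PhotonLoss.exists_isPredualState_lossEvol l T hc
  refine ⟨?_, ρT, ⟨hst, fun _ h' => h'.unique hst⟩, fun Δt N hΔt hN => ?_⟩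
  · rw [PhotonLoss.weightedTraceNorm_eq_ofReal l hc hρ₀]
    exact ENNReal.ofReal_lt_top
  · exact PhotonLoss.traceNorm_sub_iterate_scheme_le l hst hcT hc hρ₀ hΔt.le hN
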